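/- **Setting.** Let $\mathcal X,\mathcal Y$ be separable real Hilbert spaces, $\gamma$ a Borel probability measure on $\mathcal X$, $\sigma>0$, and let $G_0:\mathcal X\to\mathcal Y$ be Borel measurable with $\|G_0\|_\infty<\infty$, where $\|G\|_\infty:=\sup_{x\in\operatorname{supp}(\gamma)}\|G(x)\|_{\mathcal Y}$. For $n\ge 1$ one observes $x_1,\dots,x_n\overset{iid}{\sim}\gamma$ and $y_i=G_0(x_i)+\sigma\varepsilon_i$, where the noise $(\varepsilon_i)$ is independent of the design $(x_i)$ and is of one of two types. * *White noise*: the $\varepsilon_i=(\langle\varepsilon_i,y\rangle)_{y\in\mathcal Y}$ are independent centred Gaussian processes indexed by $\mathcal Y$ with $\operatorname{Cov}(\langle\varepsilon_i,y\rangle,\langle\varepsilon_i,y'\rangle)=\langle y,y'\rangle_{\mathcal Y}$. As usual, a separable version is taken: for $\gamma^n$-a.e. design, the process $G\mapsto(\langle\varepsilon_i,G(x_i)\rangle)_{i\le n}$, indexed by the class $\mathbf G$ below with the seminorm $\|\cdot\|_n$ below, is separable. * *Sub-Gaussian noise*: the $\varepsilon_i$ are independent $\mathcal Y$-valued random vectors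 with $\mathbb E\,\varepsilon_i=0$ and $\mathbb P(\|\varepsilon_i\|_{\mathcal Y}\ge t)\le 2e^{-t^2/2}$ for all $t\ge0$. Let $\mathbf G$ be a class of measurable maps $\mathcal X\to\mathcal Y$ that is compact with respect to $\|\cdot\|_{\infty}$, and let $F_\infty\in[0,\infty)$ satisfy $\sup_{G\in\mathbf G}\|G-G_0\|_\infty\le F_\infty$. For a class $T$ and a seminorm $\|\cdot\|$, let $H(T,\|\cdot\|,\rho)$ be the logarithm of the minimal number of open $\|\cdot\|$-balls of radius $\rho$, centred in $T$, that cover $T$. Put $\|G\|_n^2=\frac1n\sum_{i=1}^n\|G(x_i)\|_{\mathcal Y}^2$, and for $G^*\in\mathbf G$ and $\delta>0$ put $\mathbf G^*_n(\delta)=\{G\in\mathbf G:\|G-G^*\|_n\le\delta\}$ and $J(\delta)=\int_0^\delta H(\mathbf G_n^*(\delta),\|\cdot\|_n,\rho)^{1/2}\,d\rho$. Assume that $\Psi_n:(0,\infty)\to[0,\infty)$ is deterministic, that $\delta\mapsto\Psi_n(\delta)/\delta^2$ is non-increasing, and that for $\gamma^n$-a.e. $(x_1,\dots,x_n)$ one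 has $J(\delta)\le\Psi_n(\delta)$ for all $\delta>0$. Let $\hat G_n$ be any empirical risk minimizer, i.e. an $\mathbf G$-valued random element, measurable with respect to the Borel $\sigma$-algebra of $\|\cdot\|_\infty$, that almost surely minimizes $I_n(G)=\frac1n\sum_{i=1}^n\bigl(-2\langle G(x_i),y_i\rangle+\|G(x_i)\|_{\mathcal Y}^2\bigr)$ over $G\in\mathbf G$, where $\langle f,y_i\rangle:=\langle G_0(x_i),f\rangle_{\mathcal Y}+\sigma\langle\varepsilon_i,f\rangle$. **Theorem ($L^2(\gamma)$-concentration under random design).** There is a universal constant $C>0$ such that in every setting as above, for either type of noise, for all $n\ge1$, all $G^*$ and $\Psi_n$ as above, all $\delta_n,\tilde\delta_n>0$ with $$\sqrt n\,\delta_n^2\ge C\sigma\Psi_n(\delta_n)\qquad\text{and}\qquad n\tilde\delta_n^2\ge C F_\infty^2\,H(\mathbf G,\|\cdot\|_\infty,\tilde\delta_n),$$ and all $$R\ge C\max\Big\{\delta_n,\ \tilde\delta_n,\ \|G^*-G_0\|_\infty,\ \frac{\sigma+F_\infty}{\sqrt n}\Big\},$$ one has $$\mathbb P\big(\|\hat G_n-G_0\|_{L^2(\gamma)}\ge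 R\big)\le 2\exp\Big(-\frac{nR^2}{C^2(\sigma^2+F_\infty^2)}\Big).$$ -/

import Mathlib

open MeasureTheory ProbabilityTheory Set
open scoped ENNReal NNReal InnerProductSpace

namespace ERM

noncomputable section

/-- `N(T, d, δ)`: the minimal number of open `δ`-balls (centred in `T`) needed to cover `T`. -/
def coveringNumber {α : Type*} (T : Set α) (d : α → α → ℝ≥0∞) (δ : ℝ) : ℕ∞ :=
  ⨅ (c : Set α) (_ : c ⊆ T) (_ : ∀ a ∈ T, ∃ b ∈ c, d a b < ENNReal.ofReal δ), c.encard

/-- `H(T, d, δ) = log N(T, d, δ)`, with value `∞` if there is no finite cover. -/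
def entropy {α : Type*} (T : Set α) (d : α → α → ℝ≥0∞) (δ : ℝ) : ℝ≥0∞ :=
  (ENNReal.log (coveringNumber T d δ : ℝ≥0∞)).toENNReal

section Norms

variable {X Y : Type*} [NormedAddCommGroup Y]

/-- `‖F‖_{∞,S} = sup_{x ∈ S} ‖F x‖`. -/
def supNorm (S : Set X) (F : X → Y) : ℝ≥0∞ := ⨆ x ∈ S, ‖F x‖ₑ

/-- `‖F - G‖_{∞,S}`. -/
def supDist (S : Set X) (F G : X → Y) : ℝ≥0∞ := supNorm S (F - G)

/-- `‖F‖_n = (n⁻¹ ∑ᵢ ‖F xᵢ‖²)^{1/2}` for the design points `x`. -/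
def empNorm {n : ℕ} (x : Fin n → X) (F : X → Y) : ℝ :=
  √((1 / (n : ℝ)) * ∑ i, ‖F (x i)‖ ^ 2)

/-- `‖F - G‖_n`. -/
def empDist {n : ℕ} (x : Fin n → X) (F G : X → Y) : ℝ≥0∞ :=
  ENNReal.ofReal (empNorm x (F - G))

/-- The localized class `{G ∈ 𝒢 : ‖G - G*‖_n ≤ δ}`. -/
def localized {n : ℕ} (x : Fin n → X) (𝒢 : Set (X → Y)) (Gs : X → Y) (δ : ℝ) :
    Set (X → Y) :=
  {G ∈ 𝒢 | empNorm x (G - Gs) ≤ δ}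

/-- The entropy integral `J(δ) = ∫₀^δ H^{1/2}(𝒢*_n(δ), ‖·‖_n, ρ) dρ`. -/
def entropyIntegral {n : ℕ} (x : Fin n → X) (𝒢 : Set (X → Y)) (Gs : X → Y) (δ : ℝ) :
    ℝ≥0∞ :=
  ∫⁻ ρ in Ioo 0 δ, (entropy (localized x 𝒢 Gs δ) (empDist x) ρ) ^ (1 / 2 : ℝ)

/-- Compactness of a class of maps for `‖·‖_{∞,S}`, i.e. for uniform convergence on `S`. -/
def IsSupCompact (S : Set X) (𝒢 : Set (X → Y)) : Prop :=
  IsCompact (UniformOnFun.ofFun {S} '' 𝒢)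

/-- Measurability of a random map with respect to the Borel `σ`-algebra of `‖·‖_{∞,S}`. -/
def IsSupMeasurable {Ω : Type*} [MeasurableSpace Ω] (S : Set X) (G : Ω → X → Y) : Prop :=
  Measurable[_, borel (UniformOnFun X Y {S})] fun ω => UniformOnFun.ofFun {S} (G ω)

end Norms

section Noise

variable {Y : Type*} [NormedAddCommGroup Y] [InnerProductSpace ℝ Y]
variable {Ω : Type*} [MeasurableSpace Ω]

/-- A `Y`-Gaussian white noise process: a centred Gaussian process indexed by `Y` with
`Cov(W(y), W(y')) = ⟨y, y'⟩`. -/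
structure IsWhiteNoise (W : Y → Ω → ℝ) (μ : Measure Ω) : Prop where
  measurable : ∀ y, Measurable (W y)
  isGaussianProcess : IsGaussianProcess W μ
  mean_zero : ∀ y, ∫ ω, W y ω ∂μ = 0
  covariance : ∀ y y', cov[W y, W y'; μ] = ⟪y, y'⟫_ℝ

/-- White noise model: `ε i y` stands for `⟨εᵢ, y⟩`, and the processes `εᵢ` are independent
copies of the white noise process. -/
structure IsWhiteNoiseModel {n : ℕ} (ε : Fin n → Y → Ω → ℝ) (μ : Measure Ω) : Prop where
  isWhiteNoise : ∀ i, IsWhiteNoise (ε i) μ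
  indep : iIndepFun (fun i ω (y : Y) => ε i y ω) μ

/-- A centred random vector `Z` with `P(‖Z‖ ≥ t) ≤ 2 exp(-t²/(2η²))` for all `t ≥ 0`. -/
structure IsSubGaussian [MeasurableSpace Y] (Z : Ω → Y) (η : ℝ) (μ : Measure Ω) : Prop where
  measurable : Measurable Z
  mean_zero : ∫ ω, Z ω ∂μ = 0
  tail : ∀ t : ℝ, 0 ≤ t →
    μ {ω | t ≤ ‖Z ω‖} ≤ ENNReal.ofReal (2 * Real.exp (-t ^ 2 / (2 * η ^ 2)))

/-- Sub-Gaussian noise model: `ε i y` is `⟨Zᵢ, y⟩` for independent sub-Gaussian vectors `Zᵢ`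
with parameter `1`. -/
def IsSubGaussianModel [MeasurableSpace Y] {n : ℕ} (ε : Fin n → Y → Ω → ℝ)
    (μ : Measure Ω) : Prop :=
  ∃ Z : Fin n → Ω → Y, (∀ i, IsSubGaussian (Z i) 1 μ) ∧ iIndepFun Z μ ∧
    ∀ i y ω, ε i y ω = ⟪Z i ω, y⟫_ℝ

/-- A white noise process is determined by its law only up to modifications, and an arbitrary
modification may be altered at a random index. As usual, a separable modification is taken:
for almost every design `x`, the process `G ↦ (⟨εᵢ, G(xᵢ)⟩)ᵢ` on `(𝒢, ‖·‖_n)` is separable in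
Doob's sense. No continuity or boundedness of sample paths is asked for. -/
def IsSeparableVersion {X : Type*} [MeasurableSpace X] {n : ℕ} (γ : Measure X)
    (𝒢 : Set (X → Y)) (ε : Fin n → Y → Ω → ℝ) (μ : Measure Ω) : Prop :=
  ∀ᵐ x ∂(Measure.pi fun _ : Fin n => γ), ∃ D : Set (X → Y), D ⊆ 𝒢 ∧ D.Countable ∧
    ∀ᵐ ω ∂μ, ∀ G ∈ 𝒢, ∀ η : ℝ, 0 < η →
      ∃ G' ∈ D, empNorm x (G' - G) < η ∧ ∀ i, |ε i (G' (x i)) ω - ε i (G (x i)) ω| < η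

/-- The pairing `⟨yᵢ, f⟩` with the observation `yᵢ = G₀(xᵢ) + σ εᵢ`. -/
def obs {X : Type*} {n : ℕ} (G₀ : X → Y) (σ : ℝ) (ε : Fin n → Y → Ω → ℝ) (x : Fin n → X)
    (ω : Ω) (i : Fin n) (f : Y) : ℝ :=
  ⟪G₀ (x i), f⟫_ℝ + σ * ε i f ω

/-- The empirical risk `I_n(G) = n⁻¹ ∑ᵢ (-2⟨G(xᵢ), yᵢ⟩ + ‖G(xᵢ)‖²)`. -/
def empRisk {X : Type*} {n : ℕ} (G₀ : X → Y) (σ : ℝ) (ε : Fin n → Y → Ω → ℝ)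
    (x : Fin n → X) (ω : Ω) (G : X → Y) : ℝ :=
  (1 / (n : ℝ)) * ∑ i, (-2 * obs G₀ σ ε x ω i (G (x i)) + ‖G (x i)‖ ^ 2)

/-- The law `P_{G₀}` of design and noise: `x₁, …, x_n` i.i.d. `γ`, independent of the noise. -/
def jointLaw {X : Type*} [MeasurableSpace X] (n : ℕ) (γ : Measure X) (μ : Measure Ω) :
    Measure ((Fin n → X) × Ω) :=
  (Measure.pi fun _ : Fin n => γ).prod μ

/-- `Ĝ` is a measurable empirical risk minimizer over `𝒢`. -/
structure IsERM {X : Type*} [MeasurableSpace X] {n : ℕ} (S : Set X) (γ : Measure X)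
    (μ : Measure Ω) (𝒢 : Set (X → Y)) (G₀ : X → Y) (σ : ℝ) (ε : Fin n → Y → Ω → ℝ)
    (Ghat : (Fin n → X) × Ω → X → Y) : Prop where
  mem : ∀ p, Ghat p ∈ 𝒢
  measurable : IsSupMeasurable S Ghat
  minimizes : ∀ᵐ p ∂(jointLaw n γ μ), ∀ G ∈ 𝒢,
    empRisk G₀ σ ε p.1 p.2 (Ghat p) ≤ empRisk G₀ σ ε p.1 p.2 G

end Noise

/-- The standing assumption on `G₀`, `𝒢`, `G*`, `γ` and the bound `Ψ` for sample size `n`. -/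
structure Admissible {X Y : Type*} [TopologicalSpace X] [MeasurableSpace X]
    [NormedAddCommGroup Y] [MeasurableSpace Y] (n : ℕ) (γ : Measure X) (G₀ : X → Y)
    (𝒢 : Set (X → Y)) (Gs : X → Y) (Ψ : ℝ → ℝ) : Prop where
  measurable_G₀ : Measurable G₀
  measurable_class : ∀ G ∈ 𝒢, Measurable G
  mem : Gs ∈ 𝒢
  bounded_G₀ : supNorm γ.support G₀ < ∞
  compact : IsSupCompact γ.support 𝒢
  nonneg : ∀ δ : ℝ, 0 < δ → 0 ≤ Ψ δ
  entropy_bound : ∀ᵐ x ∂(Measure.pi fun _ : Fin n => γ), ∀ δ : ℝ, 0 < δ →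
    entropyIntegral x 𝒢 Gs δ ≤ ENNReal.ofReal (Ψ δ)
  antitone : AntitoneOn (fun δ : ℝ => Ψ δ / δ ^ 2) (Ioi 0)

end

end ERM

/-! If `Ghat` is at `L²(γ)`-distance at least `R` from `G₀`, then either its empirical distance is
at least `R / 4`, or the design is one on which the empirical norm badly underestimates some `G -
G₀`.

The second event concerns the design only. Since `‖G - G₀‖²` lies in `[0, F²]`, its empirical mean
has an exponential lower tail without further moment assumptions (`measure_empNorm_lt_le`). A
sup-norm `δ'`-net makes this uniform over the class, and the condition on `δ'` lets the exponent
absorb the cardinality of the net (`exists_design_exceptional_set`).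

The first event is treated for a fixed design. Minimality forces the noise increment between `Ghat`
and `Gs` to be at least of order `√n ‖Ghat - Gs‖_n² / σ` (`noiseSum_ge_of_empRisk_le`). Dudley
chaining (`measure_chaining_le`) makes this unlikely on each dyadic shell around `Gs`. Monotonicity
of `Ψ δ / δ²` carries the condition from `δ` to every shell, and the shell probabilities are
summable (`measure_fixedDesign_le`). Both noise types enter only through sub-Gaussian increments and
separability, which reduces suprema to countable sets.

Fubini then averages over designs. This needs the empirical event to be null-measurable, which
follows from compactness of the class (`aemeasurable_eval`). -/

namespace ERM

/-! ### Covering numbers, entropy and dyadic sums -/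

section Covering

variable {α : Type*}

theorem coveringNumber_antitone (T : Set α) (d : α → α → ℝ≥0∞) :
    Antitone (coveringNumber T d) := by
  intro s t hst
  unfold coveringNumber
  refine le_iInf fun c => le_iInf fun hc => le_iInf fun h => ?_
  refine iInf_le_of_le c (iInf_le_of_le hc (iInf_le_of_le (fun a ha => ?_) le_rfl))
  obtain ⟨b, hb, hab⟩ := h a ha
  exact ⟨b, hb, hab.trans_le (ENNReal.ofReal_le_ofReal hst)⟩

theorem entropy_antitone (T : Set α) (d : α → α → ℝ≥0∞) : Antitone (entropy T d) := by
  intro s t hst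
  unfold entropy
  apply EReal.toENNReal_le_toENNReal
  apply ENNReal.log_monotone
  exact_mod_cast coveringNumber_antitone T d hst

/-- A bound on the entropy yields a finite cover of controlled cardinality. -/
theorem exists_finset_cover {T : Set α} {d : α → α → ℝ≥0∞} {δ h : ℝ}
    (hh : 0 ≤ h) (hent : entropy T d δ ≤ ENNReal.ofReal h) :
    ∃ c : Finset α, (∀ b ∈ c, b ∈ T) ∧ (∀ a ∈ T, ∃ b ∈ c, d a b < ENNReal.ofReal δ) ∧
      (c.card : ℝ) ≤ Real.exp h := by
  have hlog : ENNReal.log (coveringNumber T d δ : ℝ≥0∞) ≤ (h : EReal) := by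
    refine (le_max_right 0 _).trans ((EReal.coe_toENNReal_eq_max).symm.le.trans ?_)
    have : ((ENNReal.ofReal h : ℝ≥0∞) : EReal) = (h : EReal) := by
      rw [EReal.coe_ennreal_ofReal, max_eq_left hh]
    rw [← this]
    exact_mod_cast hent
  have hle : (coveringNumber T d δ : ℝ≥0∞) ≤ ENNReal.ofReal (Real.exp h) := by
    rw [← ENNReal.log_le_log_iff, ← EReal.exp_coe, EReal.log_exp]
    exact hlog
  have hne : coveringNumber T d δ ≠ ⊤ := by
    intro htop
    rw [htop] at hle
    simp at hle
  obtain ⟨k, hk⟩ := ENat.ne_top_iff_exists.1 hne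
  have hlt : coveringNumber T d δ < (k : ℕ∞) + 1 := by
    rw [← hk]; exact_mod_cast Nat.lt_succ_self k
  simp only [coveringNumber, iInf_lt_iff] at hlt
  obtain ⟨c, hcT, hcov, hcard⟩ := hlt
  have hfin : c.Finite := by
    rw [← Set.encard_lt_top_iff]
    exact hcard.trans_le le_top
  refine ⟨hfin.toFinset, fun b hb => hcT (by simpa using hb), fun a ha => ?_, ?_⟩
  · obtain ⟨b, hb, hab⟩ := hcov a ha
    exact ⟨b, by simpa using hb, hab⟩
  · rw [hfin.encard_eq_coe_toFinset_card] at hcard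
    have h1 : hfin.toFinset.card ≤ k := by
      have : hfin.toFinset.card < k + 1 := by exact_mod_cast hcard
      omega
    have h2 : (k : ℝ) ≤ Real.exp h := by
      rw [← hk] at hle
      have : ((k : ℕ∞) : ℝ≥0∞) = ENNReal.ofReal (k : ℝ) := by simp
      rw [this] at hle
      exact (ENNReal.ofReal_le_ofReal_iff (Real.exp_pos h).le).1 hle
    exact le_trans (by exact_mod_cast h1) h2

/-- Dyadic lower Riemann sums of a non-increasing function. -/
theorem sum_dyadic_le_lintegral {f : ℝ → ℝ≥0∞} (hf : Antitone f) {δ : ℝ} (hδ : 0 < δ)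
    (m : ℕ) :
    ∑ k ∈ Finset.range m, ENNReal.ofReal (δ / 2 ^ (k + 2)) * f (δ / 2 ^ (k + 1)) ≤
      ∫⁻ ρ in Ioo 0 δ, f ρ := by
  -- Truncating the integral from below makes the induction work: each new term lives on a fresh
  -- interval of length `δ / 2 ^ (k + 2)`.
  suffices H : ∑ k ∈ Finset.range m, ENNReal.ofReal (δ / 2 ^ (k + 2)) * f (δ / 2 ^ (k + 1)) ≤
      ∫⁻ ρ in Ioo (δ / 2 ^ (m + 1)) δ, f ρ from
    H.trans (lintegral_mono_set (Ioo_subset_Ioo_left (by positivity)))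
  induction m with
  | zero => simp
  | succ m ih =>
    rw [Finset.sum_range_succ]
    have hhalf : δ / 2 ^ (m + 1) = 2 * (δ / 2 ^ (m + 2)) := by rw [pow_succ _ (m + 1)]; field_simp
    have hp : 0 < δ / 2 ^ (m + 2) := by positivity
    have hlt : δ / 2 ^ (m + 1) < δ := by
      apply div_lt_self hδ
      exact one_lt_pow₀ (by norm_num) (by omega)
    have hdisj : Disjoint (Ioo (δ / 2 ^ (m + 1)) δ) (Ioc (δ / 2 ^ (m + 2)) (δ / 2 ^ (m + 1))) := by
      rw [Set.disjoint_left]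
      rintro x ⟨h1, _⟩ ⟨_, h2⟩
      linarith
    calc _ ≤ (∫⁻ ρ in Ioo (δ / 2 ^ (m + 1)) δ, f ρ) +
          ∫⁻ ρ in Ioc (δ / 2 ^ (m + 2)) (δ / 2 ^ (m + 1)), f ρ := by
          refine add_le_add ih ?_
          calc _ = ∫⁻ _ in Ioc (δ / 2 ^ (m + 2)) (δ / 2 ^ (m + 1)), f (δ / 2 ^ (m + 1)) := by
                rw [setLIntegral_const, Real.volume_Ioc, mul_comm, hhalf]
                congr 2
                ring
            _ ≤ _ := setLIntegral_mono' measurableSet_Ioc fun x hx => hf hx.2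
      _ = ∫⁻ ρ in Ioo (δ / 2 ^ (m + 1)) δ ∪ Ioc (δ / 2 ^ (m + 2)) (δ / 2 ^ (m + 1)), f ρ :=
          (lintegral_union measurableSet_Ioc hdisj).symm
      _ ≤ _ := by
          apply lintegral_mono_set
          rintro x (⟨h1, h2⟩ | ⟨h1, h2⟩)
          · exact ⟨by show δ / 2 ^ (m + 2) < x; linarith, h2⟩
          · exact ⟨h1, h2.trans_lt hlt⟩

end Covering

/-! ### Chaining for processes with sub-Gaussian increments -/

section Chaining

theorem tsum_ofReal_exp_le {q : ℝ} (hq : 1 ≤ q) :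
    ∑' k : ℕ, ENNReal.ofReal (Real.exp (-(((k : ℝ) + 1) * q))) ≤
      ENNReal.ofReal (2 * Real.exp (-q)) := by
  have hle : ∀ k : ℕ, Real.exp (-(((k : ℝ) + 1) * q)) ≤ Real.exp (-q) * (1 / 2) ^ k := by
    intro k
    have h2 : Real.exp (-q) ≤ 1 / 2 := by
      have : Real.exp (-q) ≤ Real.exp (-1) := Real.exp_le_exp.2 (by linarith)
      have h3 := Real.add_one_le_exp (1 : ℝ)
      have h4 : Real.exp (-1) ≤ 1 / 2 := by
        rw [Real.exp_neg, one_div]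
        exact inv_anti₀ (by norm_num) (by linarith)
      linarith
    calc Real.exp (-(((k : ℝ) + 1) * q)) = Real.exp (-q) * Real.exp (-q) ^ k := by
          rw [← Real.exp_nat_mul, ← Real.exp_add]; ring_nf
      _ ≤ _ := by gcongr
  have hsum : HasSum (fun k : ℕ => Real.exp (-q) * (1 / 2 : ℝ) ^ k) (Real.exp (-q) * 2) :=
    hasSum_geometric_two.mul_left _
  calc _ ≤ ∑' k : ℕ, ENNReal.ofReal (Real.exp (-q) * (1 / 2) ^ k) :=
        ENNReal.tsum_le_tsum fun k => ENNReal.ofReal_le_ofReal (hle k)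
    _ = ENNReal.ofReal (∑' k : ℕ, Real.exp (-q) * (1 / 2) ^ k) :=
        (ENNReal.ofReal_tsum_of_nonneg (fun k => by positivity) hsum.summable).symm
    _ = _ := by rw [hsum.tsum_eq, mul_comm]

theorem sum_div_two_pow_le (m : ℕ) :
    ∑ k ∈ Finset.range m, ((k : ℝ) + 1) / 2 ^ (k + 1) ≤ 2 := by
  have : ∑ k ∈ Finset.range m, ((k : ℝ) + 1) / 2 ^ (k + 1) = 2 - ((m : ℝ) + 2) / 2 ^ m := by
    induction m with
    | zero => norm_num
    | succ m ih =>
      rw [Finset.sum_range_succ, ih]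
      push_cast
      rw [pow_succ]
      field_simp
      ring
  rw [this]
  have : 0 ≤ ((m : ℝ) + 2) / 2 ^ m := by positivity
  linarith

variable {α Ω : Type*} [MeasurableSpace Ω]

/-- Dudley's entropy bound in deviation form, for a process with sub-Gaussian increments. -/
theorem measure_chaining_le {μ : Measure Ω} {T : Set α} {d : α → α → ℝ≥0∞} {t₀ : α}
    (ht₀ : t₀ ∈ T) {δ : ℝ} (hδ : 0 < δ) (hrad : ∀ a ∈ T, d a t₀ ≤ ENNReal.ofReal δ)
    {W : α → Ω → ℝ} {κ : ℝ} (hκ : 0 < κ)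
    (htail : ∀ a ∈ T, ∀ b ∈ T, ∀ r : ℝ, 0 < r → d a b ≤ ENNReal.ofReal r → ∀ u : ℝ, 0 ≤ u →
      μ {ω | r * u ≤ W a ω - W b ω} ≤ ENNReal.ofReal (Real.exp (-u ^ 2 / (2 * κ))))
    {J : ℝ} (hJ0 : 0 ≤ J)
    (hJ : ∫⁻ ρ in Ioo 0 δ, (entropy T d ρ) ^ (1 / 2 : ℝ) ≤ ENNReal.ofReal J)
    {D : Set α} (hDT : D ⊆ T) (hD : D.Countable) {a : ℝ} (ha : 1 ≤ a) :
    μ {ω | ∃ t ∈ D, √(2 * κ) * (4 * J + 5 * a * δ) ≤ W t ω - W t₀ ω} ≤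
      ENNReal.ofReal (4 * Real.exp (-a ^ 2)) := by
  rcases D.eq_empty_or_nonempty with rfl | hDne
  · simp
  -- The enumeration fixes the depth of chaining: `t j` is followed only down to level `j`, and the
  -- remaining increment is bounded individually. No path continuity is needed.
  obtain ⟨t, rfl⟩ := hD.exists_eq_range hDne
  have htT : ∀ j, t j ∈ T := fun j => hDT ⟨j, rfl⟩
  set s : ℝ := √(2 * κ) with hs
  have hs0 : 0 < s := Real.sqrt_pos.2 (by positivity)
  have hs2 : s ^ 2 = 2 * κ := Real.sq_sqrt (by positivity)
  have hmono : Antitone fun ρ => (entropy T d ρ) ^ (1 / 2 : ℝ) := fun x y hxy =>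
    ENNReal.rpow_le_rpow (entropy_antitone T d hxy) (by norm_num)
  have hsum := fun m => (sum_dyadic_le_lintegral hmono hδ m).trans hJ
  have hfin : ∀ k : ℕ, entropy T d (δ / 2 ^ (k + 1)) ≠ ∞ := by
    intro k htop
    have h1 := hsum (k + 1)
    rw [Finset.sum_range_succ, htop] at h1
    have h2 : ENNReal.ofReal (δ / 2 ^ (k + 2)) ≠ 0 := by
      rw [Ne, ENNReal.ofReal_eq_zero, not_le]; positivity
    rw [ENNReal.top_rpow_of_pos (by norm_num), ENNReal.mul_top h2] at h1
    simp at h1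
  set h : ℕ → ℝ := fun k => (entropy T d (δ / 2 ^ k)).toReal with hh
  have hh0 : ∀ k, 0 ≤ h k := fun k => ENNReal.toReal_nonneg
  have hsumR : ∀ m, ∑ k ∈ Finset.range m, δ / 2 ^ (k + 2) * √(h (k + 1)) ≤ J := by
    intro m
    have h1 := hsum m
    have h2 : ∑ k ∈ Finset.range m, ENNReal.ofReal (δ / 2 ^ (k + 2)) *
        (entropy T d (δ / 2 ^ (k + 1))) ^ (1 / 2 : ℝ) =
        ENNReal.ofReal (∑ k ∈ Finset.range m, δ / 2 ^ (k + 2) * √(h (k + 1))) := by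
      rw [ENNReal.ofReal_sum_of_nonneg (fun k _ => by positivity)]
      refine Finset.sum_congr rfl fun k _ => ?_
      rw [ENNReal.ofReal_mul (by positivity), Real.sqrt_eq_rpow,
        ← ENNReal.ofReal_rpow_of_nonneg (hh0 _) (by norm_num), ENNReal.ofReal_toReal (hfin k)]
    rw [h2] at h1
    exact (ENNReal.ofReal_le_ofReal_iff hJ0).1 h1
  -- Level `0` is the single point `t₀`, so every chain ends there and the entropy at radius `δ` is
  -- never used.
  have hcov : ∀ k : ℕ, ∃ c : Finset α, (∀ b ∈ c, b ∈ T) ∧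
      (∀ x ∈ T, ∃ b ∈ c, d x b ≤ ENNReal.ofReal (δ / 2 ^ k)) ∧ (k = 0 → c = {t₀}) ∧
      (k ≠ 0 → (c.card : ℝ) ≤ Real.exp (h k)) := by
    intro k
    rcases k with _ | k
    · exact ⟨{t₀}, by simpa using ht₀, fun x hx => ⟨t₀, by simp, by simpa using hrad x hx⟩,
        fun _ => rfl, fun h => absurd rfl h⟩
    · obtain ⟨c, h1, h2, h3⟩ := exists_finset_cover (hh0 (k + 1))
        (ENNReal.ofReal_toReal (hfin k)).ge
      refine ⟨c, h1, fun x hx => ?_, fun h => by omega, fun _ => h3⟩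
      obtain ⟨b, hb, hxb⟩ := h2 x hx
      exact ⟨b, hb, hxb.le⟩
  choose c hcT hcc hc0 hcard using hcov
  have hπ : ∀ k : ℕ, ∀ x : α, ∃ b, x ∈ T → b ∈ c k ∧ d x b ≤ ENNReal.ofReal (δ / 2 ^ k) := by
    intro k x
    by_cases hx : x ∈ T
    · obtain ⟨b, hb⟩ := hcc k x hx
      exact ⟨b, fun _ => hb⟩
    · exact ⟨x, fun h => absurd h hx⟩
  choose π hπ using hπ
  -- Under the root, `h (k + 1)` pays for the union over `c (k + 1)`, and `(k + 1) * a ^ 2` makes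
  -- the failure probabilities summable over levels.
  set η : ℕ → ℝ := fun k => (δ / 2 ^ k) * (s * √(h (k + 1) + (k + 1) * a ^ 2)) with hη
  have hηsum : ∀ m, ∑ k ∈ Finset.range m, η k ≤ s * (4 * J + 4 * a * δ) := by
    intro m
    have hle : ∀ k ∈ Finset.range m, η k ≤
        s * 4 * (δ / 2 ^ (k + 2) * √(h (k + 1))) + s * 2 * a * δ * (((k : ℝ) + 1) / 2 ^ (k + 1)) := by
      intro k _
      have h1 : √(h (k + 1) + (k + 1) * a ^ 2) ≤ √(h (k + 1)) + ((k : ℝ) + 1) * a := by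
        rw [Real.sqrt_le_left (by positivity)]
        have := Real.sq_sqrt (hh0 (k + 1))
        have h3 : 0 ≤ √(h (k + 1)) * (((k : ℝ) + 1) * a) := by positivity
        have h4 : ((k : ℝ) + 1) * a ^ 2 ≤ (((k : ℝ) + 1) * a) ^ 2 := by
          have : (0 : ℝ) ≤ k := Nat.cast_nonneg k
          have h5 := sq_nonneg a
          nlinarith [mul_nonneg this h5, mul_nonneg (mul_nonneg this this) h5]
        nlinarith
      calc η k ≤ (δ / 2 ^ k) * (s * (√(h (k + 1)) + ((k : ℝ) + 1) * a)) := by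
            simp only [hη]; gcongr
        _ = _ := by
            rw [pow_succ _ (k + 1), pow_succ]; field_simp; ring
    calc _ ≤ _ := Finset.sum_le_sum hle
      _ = s * 4 * (∑ k ∈ Finset.range m, δ / 2 ^ (k + 2) * √(h (k + 1))) +
          s * 2 * a * δ * ∑ k ∈ Finset.range m, (((k : ℝ) + 1) / 2 ^ (k + 1)) := by
          rw [Finset.sum_add_distrib, Finset.mul_sum, Finset.mul_sum]
      _ ≤ s * 4 * J + s * 2 * a * δ * 2 := by
          gcongr
          · exact hsumR m
          · exact sum_div_two_pow_le m
      _ = _ := by ring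
  -- `A k` is failure of a link from level `k + 1` to level `k`; each fine point has one parent, so
  -- no union over pairs arises. `B j` is failure of the last step from `t j`; its threshold is `s *
  -- a * δ` for every `j`, while the tail improves with `j`.
  set A : ℕ → Set Ω := fun k => ⋃ b ∈ c (k + 1), {ω | η k ≤ W b ω - W (π k b) ω} with hA
  set B : ℕ → Set Ω := fun j => {ω | (δ / 2 ^ j) * (s * a * 2 ^ j) ≤ W (t j) ω - W (π j (t j)) ω}
    with hB
  have hAm : ∀ k : ℕ, μ (A k) ≤ ENNReal.ofReal (Real.exp (-(((k : ℝ) + 1) * a ^ 2))) := by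
    intro k
    set v : ℝ := h (k + 1) + (k + 1) * a ^ 2 with hv
    have hv0 : 0 ≤ v := add_nonneg (hh0 _) (by positivity)
    calc μ (A k) ≤ ∑ b ∈ c (k + 1), μ {ω | η k ≤ W b ω - W (π k b) ω} :=
          measure_biUnion_finset_le _ _
      _ ≤ ∑ b ∈ c (k + 1), ENNReal.ofReal (Real.exp (-v)) := by
          refine Finset.sum_le_sum fun b hb => ?_
          have hbT := hcT _ _ hb
          obtain ⟨h1, h2⟩ := hπ k b hbT
          refine (htail b hbT _ (hcT _ _ h1) (δ / 2 ^ k) (by positivity) h2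
            (s * √v) (by positivity)).trans (ENNReal.ofReal_le_ofReal (le_of_eq ?_))
          rw [mul_pow, hs2, Real.sq_sqrt hv0]
          congr 1
          field_simp
      _ = ENNReal.ofReal ((c (k + 1)).card * Real.exp (-v)) := by
          rw [Finset.sum_const, nsmul_eq_mul, ENNReal.ofReal_mul (by positivity)]
          simp
      _ ≤ _ := by
          apply ENNReal.ofReal_le_ofReal
          calc _ ≤ Real.exp (h (k + 1)) * Real.exp (-v) := by
                gcongr
                exact hcard (k + 1) (by omega)
            _ = _ := by rw [← Real.exp_add, hv]; congr 1; ring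
  have hBm : ∀ j : ℕ, μ (B j) ≤ ENNReal.ofReal (Real.exp (-(((j : ℝ) + 1) * a ^ 2))) := by
    intro j
    obtain ⟨h1, h2⟩ := hπ j (t j) (htT j)
    refine (htail _ (htT j) _ (hcT _ _ h1) (δ / 2 ^ j) (by positivity) h2
      (s * a * 2 ^ j) (by positivity)).trans (ENNReal.ofReal_le_ofReal (Real.exp_le_exp.2 ?_))
    have h3 : -(s * a * 2 ^ j) ^ 2 / (2 * κ) = -(a ^ 2 * (2 ^ j) ^ 2) := by
      rw [mul_pow, mul_pow, hs2]; field_simp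
    have h4 : (j : ℝ) + 1 ≤ 2 ^ j := by
      have : j + 1 ≤ 2 ^ j := Nat.lt_two_pow_self
      exact_mod_cast this
    have h5 : (1 : ℝ) ≤ 2 ^ j := one_le_pow₀ (by norm_num)
    rw [h3, neg_le_neg_iff, mul_comm]
    gcongr
    nlinarith
  have hsub : {ω | ∃ x ∈ range t, s * (4 * J + 5 * a * δ) ≤ W x ω - W t₀ ω} ⊆
      (⋃ k, A k) ∪ ⋃ j, B j := by
    rintro ω ⟨_, ⟨j, rfl⟩, hj⟩
    by_contra hcon
    simp only [mem_union, mem_iUnion, not_or, not_exists] at hcon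
    obtain ⟨hnA, hnB⟩ := hcon
    have hlink : ∀ k, ∀ b ∈ c k, W b ω - W t₀ ω ≤ ∑ l ∈ Finset.range k, η l := by
      intro k
      induction k with
      | zero =>
        intro b hb
        rw [hc0 0 rfl, Finset.mem_singleton] at hb
        simp [hb]
      | succ k ih =>
        intro b hb
        have h1 := hnA k
        simp only [hA, mem_iUnion, not_exists, mem_ofPred_eq, not_le] at h1
        have h2 := h1 b hb
        have h3 := ih _ (hπ k b (hcT _ _ hb)).1
        rw [Finset.sum_range_succ]
        linarith
    have h1 := hlink j _ (hπ j (t j) (htT j)).1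
    have h2 : W (t j) ω - W (π j (t j)) ω < (δ / 2 ^ j) * (s * a * 2 ^ j) := not_le.1 (hnB j)
    have h3 : (δ / 2 ^ j) * (s * a * 2 ^ j) = s * a * δ := by field_simp
    have h4 := hηsum j
    rw [h3] at h2
    have h5 : s * (4 * J + 5 * a * δ) = s * (4 * J + 4 * a * δ) + s * a * δ := by ring
    linarith
  have hq : (1 : ℝ) ≤ a ^ 2 := one_le_pow₀ ha
  calc _ ≤ μ ((⋃ k, A k) ∪ ⋃ j, B j) := measure_mono hsub
    _ ≤ μ (⋃ k, A k) + μ (⋃ j, B j) := measure_union_le _ _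
    _ ≤ (∑' k, μ (A k)) + ∑' j, μ (B j) :=
        add_le_add (measure_iUnion_le _) (measure_iUnion_le _)
    _ ≤ ENNReal.ofReal (2 * Real.exp (-a ^ 2)) + ENNReal.ofReal (2 * Real.exp (-a ^ 2)) :=
        add_le_add ((ENNReal.tsum_le_tsum hAm).trans (tsum_ofReal_exp_le hq))
          ((ENNReal.tsum_le_tsum hBm).trans (tsum_ofReal_exp_le hq))
    _ = _ := by
        rw [← ENNReal.ofReal_add (by positivity) (by positivity)]
        congr 1
        ring

end Chaining

/-! ### From norm tails to moment generating functions -/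

section SubGaussian

variable {Ω : Type*} [MeasurableSpace Ω] {μ : Measure Ω}

theorem hasSubgaussianMGF_mono {ξ : Ω → ℝ} {c c' : ℝ≥0} (h : HasSubgaussianMGF ξ c μ)
    (hc : c ≤ c') : HasSubgaussianMGF ξ c' μ where
  integrable_exp_mul := h.integrable_exp_mul
  mgf_le t := (h.mgf_le t).trans (Real.exp_le_exp.2 (by gcongr))

/-- After integration against a centred variable the linear term vanishes, leaving a bound of second
order. -/
theorem exp_le_add_exp_sq (x : ℝ) : Real.exp x ≤ x + Real.exp (x ^ 2) := by
  have h1 := Real.add_one_le_exp (x ^ 2)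
  rcases le_or_gt |x| 1 with hx | hx
  · have := (abs_le.1 (Real.abs_exp_sub_one_sub_id_le hx)).2
    linarith
  · rcases lt_abs.1 hx with hx | hx
    · have : Real.exp x ≤ Real.exp (x ^ 2) := Real.exp_le_exp.2 (by nlinarith)
      linarith
    · have : Real.exp x ≤ 1 := Real.exp_le_one_iff.2 (by linarith)
      nlinarith

/-- Layer-cake formula: `t ≤ V² / 4` has probability at most `2 exp(-2t)`, so the integrand against
`exp t` is at most `2 exp(-t)`. This gives `2`, plus `1` for `exp 0`. -/
theorem lintegral_exp_sq_le [IsProbabilityMeasure μ] {V : Ω → ℝ} (hV : Measurable V)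
    (hV0 : ∀ ω, 0 ≤ V ω)
    (htail : ∀ t : ℝ, 0 ≤ t → μ {ω | t ≤ V ω} ≤ ENNReal.ofReal (2 * Real.exp (-t ^ 2 / 2))) :
    ∫⁻ ω, ENNReal.ofReal (Real.exp (V ω ^ 2 / 4)) ∂μ ≤ 3 := by
  have hlc := lintegral_comp_eq_lintegral_meas_le_mul μ (f := fun ω => V ω ^ 2 / 4) (g := Real.exp)
    (Filter.Eventually.of_forall fun ω => by positivity) (by fun_prop)
    (fun t _ => Real.continuous_exp.intervalIntegrable _ _)
    (Filter.Eventually.of_forall fun t => (Real.exp_pos t).le)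
  simp only [integral_exp, Real.exp_zero] at hlc
  have hbound : ∫⁻ t in Ioi (0 : ℝ), μ {ω | t ≤ V ω ^ 2 / 4} * ENNReal.ofReal (Real.exp t) ≤ 2 := by
    calc _ ≤ ∫⁻ t in Ioi (0 : ℝ), ENNReal.ofReal (2 * Real.exp (-t)) := by
          refine setLIntegral_mono' measurableSet_Ioi fun t ht => ?_
          have ht : 0 < t := ht
          have hset : {ω | t ≤ V ω ^ 2 / 4} = {ω | 2 * √t ≤ V ω} := by
            ext ω
            show t ≤ V ω ^ 2 / 4 ↔ 2 * √t ≤ V ω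
            rw [← Real.sqrt_le_sqrt_iff (by have := hV0 ω; positivity)]
            have : √(V ω ^ 2 / 4) = V ω / 2 := by
              rw [show V ω ^ 2 / 4 = (V ω / 2) ^ 2 by ring]
              exact Real.sqrt_sq (by have := hV0 ω; positivity)
            rw [this]
            constructor <;> intro h <;> linarith
          rw [hset]
          calc _ ≤ ENNReal.ofReal (2 * Real.exp (-(2 * √t) ^ 2 / 2)) * ENNReal.ofReal (Real.exp t) :=
                mul_le_mul_left (htail _ (by positivity)) _
            _ = _ := by
                rw [← ENNReal.ofReal_mul (by positivity), mul_assoc, ← Real.exp_add, mul_pow,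
                  Real.sq_sqrt ht.le]
                congr 3
                ring
      _ = ENNReal.ofReal (∫ t in Ioi (0 : ℝ), 2 * Real.exp (-t)) := by
          rw [ofReal_integral_eq_lintegral_ofReal]
          · exact (integrableOn_exp_neg_Ioi 0).const_mul 2
          · exact Filter.Eventually.of_forall fun t => by positivity
      _ = 2 := by
          rw [integral_const_mul, integral_exp_neg_Ioi_zero]
          norm_num
  calc _ = ∫⁻ ω, (ENNReal.ofReal (Real.exp (V ω ^ 2 / 4) - 1) + 1) ∂μ := by
        refine lintegral_congr fun ω => ?_
        rw [← ENNReal.ofReal_one, ← ENNReal.ofReal_add]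
        · congr 1; ring
        · rw [sub_nonneg]; exact Real.one_le_exp (by positivity)
        · norm_num
    _ = (∫⁻ ω, ENNReal.ofReal (Real.exp (V ω ^ 2 / 4) - 1) ∂μ) + 1 := by
        rw [lintegral_add_right _ measurable_const]
        simp
    _ ≤ 2 + 1 := by
        rw [hlc]
        gcongr
    _ = 3 := by norm_num

/-- For small `t * l`, centring removes the linear term and convexity of `exp` with weight `4 (t
l)²` gives `1 + 8 (t l)²`. For large `t * l`, centring is not needed: Young's inequality gives `3
exp((t l)²)`, and the `3` is absorbed by `exp(7 (t l)²)`. -/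
theorem hasSubgaussianMGF_of_exp_sq [IsProbabilityMeasure μ] {V ξ : Ω → ℝ} (hV : Measurable V)
    (hξ : Measurable ξ) {l : ℝ≥0} (hξV : ∀ ω, |ξ ω| ≤ l * V ω)
    (hexp : ∫⁻ ω, ENNReal.ofReal (Real.exp (V ω ^ 2 / 4)) ∂μ ≤ 3)
    (hmean : ∫ ω, ξ ω ∂μ = 0) : HasSubgaussianMGF ξ (16 * l ^ 2) μ := by
  have hVint : Integrable (fun ω => Real.exp (V ω ^ 2 / 4)) μ := by
    refine ⟨by fun_prop, ?_⟩
    rw [hasFiniteIntegral_iff_ofReal (Filter.Eventually.of_forall fun ω => (Real.exp_pos _).le)]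
    exact hexp.trans_lt (by simp)
  have hVle : ∫ ω, Real.exp (V ω ^ 2 / 4) ∂μ ≤ 3 := by
    rw [← ofReal_integral_eq_lintegral_ofReal hVint
      (Filter.Eventually.of_forall fun ω => (Real.exp_pos _).le)] at hexp
    have : ENNReal.ofReal (∫ ω, Real.exp (V ω ^ 2 / 4) ∂μ) ≤ ENNReal.ofReal 3 := by
      simpa using hexp
    exact (ENNReal.ofReal_le_ofReal_iff (by norm_num)).1 this
  have hpt : ∀ t ω, Real.exp (t * ξ ω) ≤ Real.exp ((t * l) ^ 2) * Real.exp (V ω ^ 2 / 4) := by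
    intro t ω
    rw [← Real.exp_add, Real.exp_le_exp]
    have h1 : t * ξ ω ≤ |t| * l * V ω := by
      calc t * ξ ω ≤ |t * ξ ω| := le_abs_self _
        _ = |t| * |ξ ω| := abs_mul _ _
        _ ≤ |t| * (l * V ω) := by gcongr; exact hξV ω
        _ = _ := by ring
    have h2 : (t * l) ^ 2 = (|t| * l) ^ 2 := by rw [mul_pow, mul_pow, sq_abs]
    rw [h2]
    nlinarith [sq_nonneg (|t| * l - V ω / 2)]
  have hint : ∀ t, Integrable (fun ω => Real.exp (t * ξ ω)) μ := by
    intro t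
    refine (hVint.const_mul (Real.exp ((t * l) ^ 2))).mono (by fun_prop)
      (Filter.Eventually.of_forall fun ω => ?_)
    rw [Real.norm_of_nonneg (Real.exp_pos _).le, Real.norm_of_nonneg (by positivity)]
    exact hpt t ω
  refine ⟨hint, fun t => ?_⟩
  have hc : ((16 * l ^ 2 : ℝ≥0) : ℝ) * t ^ 2 / 2 = 8 * (t * l) ^ 2 := by
    push_cast; ring
  rw [hc, mgf]
  rcases le_or_gt (4 * (t * l) ^ 2) 1 with hs | hs
  · have hξint : Integrable ξ μ := by
      refine (hVint.const_mul (l : ℝ)).mono (by fun_prop)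
        (Filter.Eventually.of_forall fun ω => ?_)
      rw [Real.norm_eq_abs, Real.norm_of_nonneg (by positivity)]
      refine (hξV ω).trans ?_
      gcongr
      have := Real.add_one_le_exp (V ω ^ 2 / 4)
      nlinarith [sq_nonneg (V ω / 2 - 1)]
    have hle : ∀ ω, Real.exp (t * ξ ω) ≤
        t * ξ ω + (4 * (t * l) ^ 2 * Real.exp (V ω ^ 2 / 4) + (1 - 4 * (t * l) ^ 2)) := by
      intro ω
      refine (exp_le_add_exp_sq _).trans (add_le_add le_rfl ?_)
      have h1 : (t * ξ ω) ^ 2 ≤ 4 * (t * l) ^ 2 * (V ω ^ 2 / 4) + (1 - 4 * (t * l) ^ 2) * 0 := by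
        have : ξ ω ^ 2 ≤ (l * V ω) ^ 2 := sq_le_sq.2 ((hξV ω).trans (le_abs_self _))
        have h2 := mul_le_mul_of_nonneg_left this (sq_nonneg t)
        nlinarith
      refine (Real.exp_le_exp.2 h1).trans ?_
      have := convexOn_exp.2 (mem_univ (V ω ^ 2 / 4)) (mem_univ 0)
        (by positivity : 0 ≤ 4 * (t * l) ^ 2) (by linarith : 0 ≤ 1 - 4 * (t * l) ^ 2) (by ring)
      simpa using this
    have h8 := Real.add_one_le_exp (8 * (t * l) ^ 2)
    calc _ ≤ ∫ ω, (t * ξ ω + (4 * (t * l) ^ 2 * Real.exp (V ω ^ 2 / 4) + (1 - 4 * (t * l) ^ 2))) ∂μ :=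
          integral_mono (hint t) ((hξint.const_mul t).add
            ((hVint.const_mul _).add (integrable_const _))) hle
      _ = 4 * (t * l) ^ 2 * ∫ ω, Real.exp (V ω ^ 2 / 4) ∂μ + (1 - 4 * (t * l) ^ 2) := by
          have h1 : Integrable (fun ω => 4 * (t * l) ^ 2 * Real.exp (V ω ^ 2 / 4)) μ :=
            hVint.const_mul _
          have h2 : Integrable (fun ω => 4 * (t * l) ^ 2 * Real.exp (V ω ^ 2 / 4) +
            (1 - 4 * (t * l) ^ 2)) μ := h1.add (integrable_const _)
          rw [integral_add (hξint.const_mul t) h2, integral_add h1 (integrable_const _),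
            integral_const_mul, integral_const_mul, hmean]
          simp
      _ ≤ 4 * (t * l) ^ 2 * 3 + (1 - 4 * (t * l) ^ 2) := by gcongr
      _ ≤ _ := by linarith
  · calc _ ≤ ∫ ω, Real.exp ((t * l) ^ 2) * Real.exp (V ω ^ 2 / 4) ∂μ :=
          integral_mono (hint t) (hVint.const_mul _) (hpt t)
      _ = Real.exp ((t * l) ^ 2) * ∫ ω, Real.exp (V ω ^ 2 / 4) ∂μ := integral_const_mul _ _
      _ ≤ Real.exp ((t * l) ^ 2) * Real.exp (7 * (t * l) ^ 2) := by
          gcongr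
          refine hVle.trans ?_
          have := Real.quadratic_le_exp_of_nonneg (by positivity : 0 ≤ 7 * (t * l) ^ 2)
          nlinarith
      _ = _ := by rw [← Real.exp_add]; congr 1; ring

end SubGaussian

/-! ### The two noise models: increments and separability -/

section Noise

variable {X Y : Type*} [NormedAddCommGroup Y] [InnerProductSpace ℝ Y]
variable {Ω : Type*} [MeasurableSpace Ω] {μ : Measure Ω} {n : ℕ}

/-- The increments `⟨εᵢ, y⟩ - ⟨εᵢ, y'⟩` are sub-Gaussian with variance proxy `16 ‖y - y'‖²` and
independent in `i`. -/
structure HasSubgaussianIncrements (ε : Fin n → Y → Ω → ℝ) (μ : Measure Ω) : Prop where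
  subgaussian : ∀ i y y',
    HasSubgaussianMGF (fun ω => ε i y ω - ε i y' ω) (16 * ‖y - y'‖₊ ^ 2) μ
  indep : ∀ y y' : Fin n → Y, iIndepFun (fun i ω => ε i (y i) ω - ε i (y' i) ω) μ

theorem IsWhiteNoiseModel.hasSubgaussianIncrements [IsProbabilityMeasure μ]
    {ε : Fin n → Y → Ω → ℝ} (h : IsWhiteNoiseModel ε μ) : HasSubgaussianIncrements ε μ where
  subgaussian i y y' := by
    have hw := h.isWhiteNoise i
    have hg := hw.isGaussianProcess.hasGaussianLaw_fun_sub (s := y) (t := y')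
    have hL : ∀ z, MemLp (ε i z) 2 μ := fun z =>
      (hw.isGaussianProcess.hasGaussianLaw_eval z).memLp_two
    have hmean : ∫ ω, (ε i y ω - ε i y' ω) ∂μ = 0 := by
      rw [integral_sub ((hL y).integrable (by norm_num)) ((hL y').integrable (by norm_num)),
        hw.mean_zero, hw.mean_zero, sub_zero]
    have hvar : Var[fun ω => ε i y ω - ε i y' ω; μ] = ‖y - y'‖ ^ 2 := by
      rw [← covariance_self hg.aemeasurable,
        covariance_fun_sub_fun_sub (hL y) (hL y') (hL y) (hL y')]
      simp only [hw.covariance]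
      rw [norm_sub_sq_real, real_inner_self_eq_norm_sq, real_inner_self_eq_norm_sq,
        real_inner_comm y y']
      ring
    have hlaw := hg.map_eq_gaussianReal
    rw [hmean, hvar] at hlaw
    have hnn : (‖y - y'‖ ^ 2).toNNReal = ‖y - y'‖₊ ^ 2 := by
      rw [Real.toNNReal_pow (norm_nonneg _), norm_toNNReal]
    rw [hnn] at hlaw
    have hbase : HasSubgaussianMGF (fun ω => ε i y ω - ε i y' ω) (‖y - y'‖₊ ^ 2) μ := by
      rw [← HasSubgaussianMGF.id_map_iff hg.aemeasurable, hlaw]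
      refine ⟨fun t => integrable_exp_mul_gaussianReal t, fun t => ?_⟩
      rw [mgf_id_gaussianReal]
      simp
    -- The Gaussian proxy is exactly `‖y - y'‖²`; the factor `16` is given away to share a constant
    -- with the sub-Gaussian model.
    refine hasSubgaussianMGF_mono hbase ?_
    calc ‖y - y'‖₊ ^ 2 = 1 * ‖y - y'‖₊ ^ 2 := (one_mul _).symm
      _ ≤ _ := by gcongr; norm_num
  indep y y' := by
    have := h.indep.comp (fun i (w : Y → ℝ) => w (y i) - w (y' i)) (fun i =>
      (measurable_pi_apply _).sub (measurable_pi_apply _))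
    exact this

variable [MeasurableSpace Y]

theorem IsSubGaussian.lintegral_exp_sq_le [BorelSpace Y] [IsProbabilityMeasure μ] {Z : Ω → Y}
    (h : IsSubGaussian Z 1 μ) : ∫⁻ ω, ENNReal.ofReal (Real.exp (‖Z ω‖ ^ 2 / 4)) ∂μ ≤ 3 :=
  ERM.lintegral_exp_sq_le h.measurable.norm (fun ω => norm_nonneg _) fun t ht => by
    simpa using h.tail t ht

theorem IsSubGaussian.integrable [TopologicalSpace.SeparableSpace Y] [BorelSpace Y]
    [IsProbabilityMeasure μ] {Z : Ω → Y}
    (h : IsSubGaussian Z 1 μ) : Integrable Z μ := by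
  have : SecondCountableTopology Y := UniformSpace.secondCountable_of_separable Y
  refine ⟨h.measurable.aestronglyMeasurable, ?_⟩
  refine lt_of_le_of_lt (lintegral_mono fun ω => ?_) (h.lintegral_exp_sq_le.trans_lt (by simp))
  rw [← ofReal_norm]
  apply ENNReal.ofReal_le_ofReal
  have := Real.add_one_le_exp (‖Z ω‖ ^ 2 / 4)
  nlinarith [sq_nonneg (‖Z ω‖ / 2 - 1)]

theorem IsSubGaussianModel.hasSubgaussianIncrements [CompleteSpace Y]
    [TopologicalSpace.SeparableSpace Y] [BorelSpace Y] [IsProbabilityMeasure μ]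
    {ε : Fin n → Y → Ω → ℝ} (h : IsSubGaussianModel ε μ) : HasSubgaussianIncrements ε μ := by
  have : SecondCountableTopology Y := UniformSpace.secondCountable_of_separable Y
  obtain ⟨Z, hZ, hind, hε⟩ := h
  have heq : ∀ i y y', (fun ω => ε i y ω - ε i y' ω) = fun ω => ⟪Z i ω, y - y'⟫_ℝ := by
    intro i y y'
    ext ω
    rw [hε, hε, inner_sub_right]
  refine ⟨fun i y y' => ?_, fun y y' => ?_⟩
  · rw [heq]
    refine hasSubgaussianMGF_of_exp_sq (hZ i).measurable.norm
      ((hZ i).measurable.inner_const) (fun ω => ?_)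
      (hZ i).lintegral_exp_sq_le ?_
    · rw [coe_nnnorm, mul_comm]
      exact abs_real_inner_le_norm _ _
    · have := integral_inner (𝕜 := ℝ) (hZ i).integrable (y - y')
      simp_rw [real_inner_comm (y - y')]
      rw [this, (hZ i).mean_zero, inner_zero_right]
  · have := hind.comp (fun i (z : Y) => ⟪z, y i - y' i⟫_ℝ) (fun i => measurable_id.inner_const)
    convert this using 2 with i
    rw [heq]
    rfl

theorem empNorm_le_of_forall {Y : Type*} [NormedAddCommGroup Y] (x : Fin n → X)
    {F : X → Y} {η : ℝ} (hη : 0 ≤ η) (h : ∀ i, ‖F (x i)‖ ≤ η) : empNorm x F ≤ η := by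
  unfold empNorm
  rw [Real.sqrt_le_left hη]
  calc (1 / (n : ℝ)) * ∑ i, ‖F (x i)‖ ^ 2 ≤ (1 / (n : ℝ)) * ∑ _i : Fin n, η ^ 2 := by
        gcongr with i
        exact h i
    _ = ((n : ℝ) / n) * η ^ 2 := by simp; ring
    _ ≤ 1 * η ^ 2 := by gcongr; exact div_self_le_one _
    _ = _ := one_mul _

/-- The process depends on `G` only through `(G (x i))ᵢ`, and is Lipschitz in that vector for each
`ω`. Maps whose value vectors are dense in the separable image of the class therefore serve for all
`ω` at once. -/
theorem IsSubGaussianModel.isSeparableVersion [TopologicalSpace.SeparableSpace Y]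
    [MeasurableSpace X]
    {ε : Fin n → Y → Ω → ℝ} (h : IsSubGaussianModel ε μ) (γ : Measure X) (𝒢 : Set (X → Y)) :
    IsSeparableVersion γ 𝒢 ε μ := by
  have : SecondCountableTopology Y := UniformSpace.secondCountable_of_separable Y
  obtain ⟨Z, -, -, hε⟩ := h
  refine Filter.Eventually.of_forall fun x => ?_
  obtain ⟨s, hs, hsd⟩ := TopologicalSpace.exists_countable_dense
    ↥((fun (G : X → Y) (i : Fin n) => G (x i)) '' 𝒢)
  have hch : ∀ v : ↥((fun (G : X → Y) (i : Fin n) => G (x i)) '' 𝒢),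
      ∃ G ∈ 𝒢, (fun i => G (x i)) = v.1 := fun v => v.2
  choose g hg𝒢 hg using hch
  refine ⟨g '' s, ?_, hs.image g, Filter.Eventually.of_forall fun ω G hG η hη => ?_⟩
  · rintro _ ⟨v, -, rfl⟩
    exact hg𝒢 v
  set M : ℝ := 1 + ∑ i, ‖Z i ω‖ with hM
  have hM1 : 1 ≤ M := by
    have : 0 ≤ ∑ i, ‖Z i ω‖ := Finset.sum_nonneg fun i _ => norm_nonneg _
    linarith
  obtain ⟨v, hv, hvs⟩ := hsd.exists_dist_lt ⟨fun i => G (x i), G, hG, rfl⟩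
    (ε := η / (2 * M)) (by positivity)
  have hpt : ∀ i, ‖g v (x i) - G (x i)‖ ≤ η / (2 * M) := by
    intro i
    rw [Subtype.dist_eq, dist_comm, ← hg v] at hvs
    rw [← dist_eq_norm]
    exact (dist_le_pi_dist (fun i => g v (x i)) (fun i => G (x i)) i).trans hvs.le
  have hsmall : η / (2 * M) < η := by
    rw [div_lt_iff₀ (by positivity)]
    nlinarith
  refine ⟨g v, ⟨v, hv, rfl⟩, ?_, fun i => ?_⟩
  · exact (empNorm_le_of_forall x (by positivity) hpt).trans_lt hsmall
  · rw [hε, hε, ← inner_sub_right]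
    have hZM : ‖Z i ω‖ ≤ M := by
      have := Finset.single_le_sum (f := fun i => ‖Z i ω‖) (fun i _ => norm_nonneg _)
        (Finset.mem_univ i)
      linarith
    calc _ ≤ ‖Z i ω‖ * ‖g v (x i) - G (x i)‖ := abs_real_inner_le_norm _ _
      _ ≤ M * (η / (2 * M)) := by gcongr; exact hpt i
      _ = η / 2 := by field_simp
      _ < η := by linarith

end Noise

/-! ### Tails of the normalized noise sum -/

section NoiseSum

variable {X Y : Type*} [NormedAddCommGroup Y]
variable {Ω : Type*} [MeasurableSpace Ω] {μ : Measure Ω} {n : ℕ}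

/-- The normalized noise sum `G ↦ n^{-1/2} ∑ᵢ ⟨εᵢ, G(xᵢ)⟩`. -/
noncomputable def noiseSum (ε : Fin n → Y → Ω → ℝ) (x : Fin n → X) (G : X → Y) (ω : Ω) : ℝ :=
  (√n)⁻¹ * ∑ i, ε i (G (x i)) ω

theorem noiseSum_tail [InnerProductSpace ℝ Y] [IsFiniteMeasure μ] (hn : 0 < n)
    {ε : Fin n → Y → Ω → ℝ} (h : HasSubgaussianIncrements ε μ) (x : Fin n → X) (G G' : X → Y)
    {r : ℝ} (hr : 0 < r) (hd : empDist x G G' ≤ ENNReal.ofReal r) {u : ℝ} (hu : 0 ≤ u) :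
    μ {ω | r * u ≤ noiseSum ε x G ω - noiseSum ε x G' ω} ≤
      ENNReal.ofReal (Real.exp (-u ^ 2 / (2 * 16))) := by
  have hn' : (0 : ℝ) < n := Nat.cast_pos.2 hn
  have hsum := HasSubgaussianMGF.sum_of_iIndepFun (s := Finset.univ)
    (h.indep (fun i => G (x i)) (fun i => G' (x i)))
    (fun i _ => h.subgaussian i (G (x i)) (G' (x i)))
  have hle : ∑ i, 16 * ‖G (x i) - G' (x i)‖₊ ^ 2 ≤ 16 * (n * r.toNNReal ^ 2) := by
    rw [← Finset.mul_sum]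
    gcongr
    rw [← NNReal.coe_le_coe]
    push_cast
    rw [Real.coe_toNNReal _ hr.le]
    have h1 : empNorm x (G - G') ≤ r := (ENNReal.ofReal_le_ofReal_iff hr.le).1 hd
    unfold empNorm at h1
    rw [Real.sqrt_le_left hr.le, one_div, inv_mul_le_iff₀ hn'] at h1
    exact h1
  have htail := (hasSubgaussianMGF_mono hsum hle).measure_ge_le
    (ε := √n * (r * u)) (by positivity)
  have hset : {ω | r * u ≤ noiseSum ε x G ω - noiseSum ε x G' ω} =
      {ω | √n * (r * u) ≤ ∑ i, (ε i (G (x i)) ω - ε i (G' (x i)) ω)} := by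
    ext ω
    have : noiseSum ε x G ω - noiseSum ε x G' ω =
        (√n)⁻¹ * ∑ i, (ε i (G (x i)) ω - ε i (G' (x i)) ω) := by
      rw [noiseSum, noiseSum, Finset.sum_sub_distrib, mul_sub]
    show r * u ≤ noiseSum ε x G ω - noiseSum ε x G' ω ↔ _
    rw [this, le_inv_mul_iff₀ (Real.sqrt_pos.2 hn')]
    rfl
  rw [hset, ← ofReal_measureReal]
  refine ENNReal.ofReal_le_ofReal (htail.trans (le_of_eq ?_))
  push_cast
  rw [Real.coe_toNNReal _ hr.le, mul_pow, Real.sq_sqrt hn'.le]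
  congr 1
  field_simp

end NoiseSum

/-! ### The empirical seminorm -/

section EmpiricalNorm

variable {X Y : Type*} [NormedAddCommGroup Y] {n : ℕ}

theorem empNorm_nonneg (x : Fin n → X) (F : X → Y) : 0 ≤ empNorm x F := Real.sqrt_nonneg _

theorem sq_empNorm (x : Fin n → X) (F : X → Y) :
    empNorm x F ^ 2 = (1 / (n : ℝ)) * ∑ i, ‖F (x i)‖ ^ 2 :=
  Real.sq_sqrt (by positivity)

theorem empNorm_eq_norm_toLp (x : Fin n → X) (F : X → Y) :
    empNorm x F = √(1 / (n : ℝ)) * ‖WithLp.toLp 2 (fun i => F (x i))‖ := by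
  rw [empNorm, Real.sqrt_mul (by positivity), PiLp.norm_eq_of_L2]

theorem empNorm_sub_le (x : Fin n → X) (F G H : X → Y) :
    empNorm x (F - H) ≤ empNorm x (F - G) + empNorm x (G - H) := by
  simp only [empNorm_eq_norm_toLp]
  rw [← mul_add]
  gcongr
  refine le_trans (le_of_eq ?_) (norm_add_le _ _)
  rw [← WithLp.toLp_add]
  congr 2
  ext i
  simp

theorem empNorm_sub_comm (x : Fin n → X) (F G : X → Y) :
    empNorm x (F - G) = empNorm x (G - F) := by
  simp only [empNorm, Pi.sub_apply, norm_sub_rev]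

end EmpiricalNorm

/-! ### Basic inequality and peeling for a fixed design -/

section FixedDesign

variable {X Y : Type*} [NormedAddCommGroup Y] [InnerProductSpace ℝ Y]
variable {Ω : Type*} {n : ℕ}

theorem empRisk_eq (G₀ : X → Y) (σ : ℝ) (ε : Fin n → Y → Ω → ℝ) (x : Fin n → X) (ω : Ω)
    (G : X → Y) :
    empRisk G₀ σ ε x ω G = empNorm x (G - G₀) ^ 2 - empNorm x G₀ ^ 2 -
      2 * σ / √n * noiseSum ε x G ω := by
  have h1 : 2 * σ / √n * noiseSum ε x G ω =
      (1 / (n : ℝ)) * ∑ i, 2 * σ * ε i (G (x i)) ω := by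
    have : (1 / (n : ℝ)) = (√n)⁻¹ * (√n)⁻¹ := by
      rw [← mul_inv, Real.mul_self_sqrt (Nat.cast_nonneg n), one_div]
    rw [noiseSum, ← Finset.mul_sum, this]
    ring
  rw [h1, sq_empNorm, sq_empNorm, ← mul_sub, ← mul_sub, ← Finset.sum_sub_distrib,
    ← Finset.sum_sub_distrib, empRisk]
  congr 1
  refine Finset.sum_congr rfl fun i _ => ?_
  rw [Pi.sub_apply, norm_sub_sq_real, obs, real_inner_comm]
  ring

/-- The basic inequality, on the part of the class that is far from `G₀`. -/
theorem noiseSum_ge_of_empRisk_le (hn : 0 < n) {σ : ℝ} (hσ : 0 < σ) {G₀ G Gs : X → Y}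
    {ε : Fin n → Y → Ω → ℝ} {x : Fin n → X} {ω : Ω} {R : ℝ} (hR : 0 < R)
    (hrisk : empRisk G₀ σ ε x ω G ≤ empRisk G₀ σ ε x ω Gs)
    (hG : R / 4 ≤ empNorm x (G - G₀)) (hGs : empNorm x (Gs - G₀) ≤ R / 16) :
    R / 8 ≤ empNorm x (G - Gs) ∧ √n * empNorm x (G - Gs) ^ 2 / (4 * σ) ≤
      noiseSum ε x G ω - noiseSum ε x Gs ω := by
  have hsn : 0 < √(n : ℝ) := Real.sqrt_pos.2 (Nat.cast_pos.2 hn)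
  set A := empNorm x (G - G₀) with hA
  set b := empNorm x (Gs - G₀) with hb
  set D := empNorm x (G - Gs) with hD
  have hb0 : 0 ≤ b := empNorm_nonneg _ _
  have hD0 : 0 ≤ D := empNorm_nonneg _ _
  have h1 : A ≤ D + b := empNorm_sub_le x G Gs G₀
  have h2 : D ≤ A + b := by
    have := empNorm_sub_le x G G₀ Gs
    rwa [empNorm_sub_comm x G₀ Gs] at this
  refine ⟨by linarith, ?_⟩
  rw [empRisk_eq, empRisk_eq] at hrisk
  set w := noiseSum ε x G ω - noiseSum ε x Gs ω with hw
  have h3 : A ^ 2 - b ^ 2 ≤ 2 * σ / √n * w := by rw [hw, mul_sub]; linarith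
  -- As `D ≤ A + b`, it suffices that `(A + b) / 2 ≤ A - b`, that is `3 * b ≤ A`.
  have h4 : D ^ 2 / 2 ≤ A ^ 2 - b ^ 2 := by
    have hbA : b ≤ A / 4 := by linarith
    nlinarith
  have h5 : D ^ 2 / 2 ≤ 2 * σ / √n * w := h4.trans h3
  rw [div_le_iff₀ (by positivity)]
  have h6 := mul_le_mul_of_nonneg_left h5 hsn.le
  have h7 : √n * (2 * σ / √n * w) = 2 * σ * w := by field_simp
  rw [h7] at h6
  nlinarith

/-- Concentration in the empirical norm for a fixed design. -/
theorem measure_fixedDesign_le [MeasurableSpace Ω] {μ : Measure Ω} [IsFiniteMeasure μ] (hn : 0 < n) {σ : ℝ} (hσ : 0 < σ)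
    {ε : Fin n → Y → Ω → ℝ} (hε : HasSubgaussianIncrements ε μ) {x : Fin n → X} {G₀ Gs : X → Y}
    {𝒢 : Set (X → Y)} (hGs : Gs ∈ 𝒢) {D : Set (X → Y)} (hD𝒢 : D ⊆ 𝒢) (hD : D.Countable)
    (hsep : ∀ᵐ ω ∂μ, ∀ G ∈ 𝒢, ∀ η : ℝ, 0 < η →
      ∃ G' ∈ D, empNorm x (G' - G) < η ∧ ∀ i, |ε i (G' (x i)) ω - ε i (G (x i)) ω| < η)
    {Ψ : ℝ → ℝ} (hΨ0 : ∀ δ : ℝ, 0 < δ → 0 ≤ Ψ δ)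
    (hΨ : AntitoneOn (fun δ : ℝ => Ψ δ / δ ^ 2) (Ioi 0))
    (hJ : ∀ δ : ℝ, 0 < δ → entropyIntegral x 𝒢 Gs δ ≤ ENNReal.ofReal (Ψ δ))
    {δ R : ℝ} (hδ : 0 < δ) (hδΨ : 10 ^ 5 * σ * Ψ δ ≤ √n * δ ^ 2) (hδR : 10 ^ 5 * δ ≤ R)
    (hσR : 10 ^ 5 * (σ / √n) ≤ R) (hGsR : empNorm x (Gs - G₀) ≤ R / 16) :
    μ {ω | ∃ G ∈ 𝒢, empRisk G₀ σ ε x ω G ≤ empRisk G₀ σ ε x ω Gs ∧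
        R / 4 ≤ empNorm x (G - G₀)} ≤
      ENNReal.ofReal (Real.exp (-(n * R ^ 2) / (10 ^ 9 * σ ^ 2))) := by
  have hn' : (0 : ℝ) < n := Nat.cast_pos.2 hn
  have hsn : 0 < √(n : ℝ) := Real.sqrt_pos.2 hn'
  have hsn2 : √(n : ℝ) ^ 2 = n := Real.sq_sqrt hn'.le
  have hR : 0 < R := by linarith
  -- Outer radii of the shells `r s / 2 ≤ ‖G - Gs‖_n < r s`, which exhaust `‖G - Gs‖_n ≥ R / 8`.
  set r : ℕ → ℝ := fun s => 2 ^ (s + 1) * (R / 8) with hr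
  have hr4 : ∀ s, R / 4 ≤ r s := by
    intro s
    have : (1 : ℝ) ≤ 2 ^ s := one_le_pow₀ (by norm_num)
    simp only [hr, pow_succ]
    nlinarith
  have hr0 : ∀ s, 0 < r s := fun s => by have := hr4 s; linarith
  -- Proportional to `r s`, so that the deviation term of the chaining bound is a small fixed
  -- multiple of `√n * r s ^ 2 / σ`. Below, `q` equals `a 0 ^ 2`.
  set a : ℕ → ℝ := fun s => √n * r s / (2000 * σ) with ha
  have hσR' : 10 ^ 5 * σ ≤ R * √n := by
    rw [← mul_div_assoc, div_le_iff₀ hsn] at hσR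
    exact hσR
  have ha1 : ∀ s, 1 ≤ a s := by
    intro s
    rw [ha, le_div_iff₀ (by positivity)]
    have := mul_le_mul_of_nonneg_left (hr4 s) hsn.le
    nlinarith
  set q : ℝ := n * R ^ 2 / (64 * 10 ^ 6 * σ ^ 2) with hq
  have hq6 : 6 ≤ q := by
    rw [hq, le_div_iff₀ (by positivity)]
    have : (10 ^ 5 * σ) ^ 2 ≤ (R * √n) ^ 2 := by gcongr
    rw [mul_pow R, hsn2] at this
    nlinarith [sq_nonneg σ]
  have haq : ∀ s : ℕ, ((s : ℝ) + 1) * q ≤ a s ^ 2 := by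
    intro s
    have h1 : a s ^ 2 = (2 ^ s) ^ 2 * q := by
      have h2 : a s = 2 ^ s * (√n * R / (8000 * σ)) := by
        simp only [ha, hr, pow_succ]
        field_simp
        norm_num
      rw [h2, mul_pow, div_pow, mul_pow, mul_pow, hsn2, hq]
      norm_num
    rw [h1]
    have h4 : (s : ℝ) + 1 ≤ 2 ^ s := by
      have : s + 1 ≤ 2 ^ s := Nat.lt_two_pow_self
      exact_mod_cast this
    have h5 : (1 : ℝ) ≤ 2 ^ s := one_le_pow₀ (by norm_num)
    have : (s : ℝ) + 1 ≤ (2 ^ s) ^ 2 := by nlinarith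
    gcongr
  have hΨr : ∀ s, Ψ (r s) ≤ √n * r s ^ 2 / (10 ^ 5 * σ) := by
    intro s
    have hle : δ ≤ r s := by have := hr4 s; linarith
    have h1 : Ψ (r s) / r s ^ 2 ≤ Ψ δ / δ ^ 2 := hΨ hδ (hr0 s) hle
    have h2 : Ψ δ / δ ^ 2 ≤ √n / (10 ^ 5 * σ) := by
      rw [div_le_div_iff₀ (by positivity) (by positivity)]
      linarith
    have h3 := h1.trans h2
    have := hr0 s
    rw [div_le_iff₀ (by positivity)] at h3
    calc _ ≤ _ := h3
      _ = _ := by ring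
  -- On shell `s` the basic inequality gives at least `√n * r s ^ 2 / (16 * σ)`; half is reserved
  -- for replacing `G` by a member of `D`.
  have hchain : ∀ s, μ {ω | ∃ G ∈ D ∩ localized x 𝒢 Gs (r s), √n * r s ^ 2 / (32 * σ) ≤
      noiseSum ε x G ω - noiseSum ε x Gs ω} ≤
      ENNReal.ofReal (4 * Real.exp (-(((s : ℝ) + 1) * q))) := by
    intro s
    have hmain := measure_chaining_le (μ := μ) (T := localized x 𝒢 Gs (r s)) (d := empDist x)
      (t₀ := Gs) ⟨hGs, by simpa [empNorm] using (hr0 s).le⟩ (hr0 s)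
      (fun G hG => ENNReal.ofReal_le_ofReal hG.2) (W := noiseSum ε x) (κ := 16) (by norm_num)
      (fun G _ G' _ ρ hρ hd u hu => noiseSum_tail hn hε x G G' hρ hd hu)
      (hΨ0 _ (hr0 s)) (hJ _ (hr0 s)) (D := D ∩ localized x 𝒢 Gs (r s)) inter_subset_right
      (hD.mono inter_subset_left) (ha1 s)
    refine le_trans (measure_mono ?_) (hmain.trans (ENNReal.ofReal_le_ofReal ?_))
    · rintro ω ⟨G, hG, hle⟩
      refine ⟨G, hG, le_trans ?_ hle⟩
      have h32 : √(2 * 16 : ℝ) ≤ 6 := by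
        rw [Real.sqrt_le_left (by norm_num)]; norm_num
      have hpos : 0 ≤ 4 * Ψ (r s) + 5 * a s * r s := by
        have h1 := hΨ0 _ (hr0 s)
        have h2 := hr0 s
        have h3 := ha1 s
        positivity
      calc _ ≤ 6 * (4 * Ψ (r s) + 5 * a s * r s) := by gcongr
        _ ≤ 6 * (4 * (√n * r s ^ 2 / (10 ^ 5 * σ)) + 5 * a s * r s) := by
            gcongr
            exact hΨr s
        _ = (24 / 10 ^ 5 + 30 / 2000) * (√n * r s ^ 2 / σ) := by
            simp only [ha]; field_simp; ring
        _ ≤ (1 / 32) * (√n * r s ^ 2 / σ) := by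
            gcongr; norm_num
        _ = _ := by field_simp
    · gcongr
      exact haq s
  have hsub : ∀ᵐ ω ∂μ, (∃ G ∈ 𝒢, empRisk G₀ σ ε x ω G ≤ empRisk G₀ σ ε x ω Gs ∧
        R / 4 ≤ empNorm x (G - G₀)) → ω ∈ ⋃ s, {ω | ∃ G ∈ D ∩ localized x 𝒢 Gs (r s),
        √n * r s ^ 2 / (32 * σ) ≤ noiseSum ε x G ω - noiseSum ε x Gs ω} := by
    filter_upwards [hsep] with ω hω
    rintro ⟨G, hG, hrisk, hfar⟩
    obtain ⟨h1, h2⟩ := noiseSum_ge_of_empRisk_le hn hσ hR hrisk hfar hGsR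
    set d := empNorm x (G - Gs) with hd
    have hd0 : 0 < d := by linarith
    obtain ⟨s, hs1, hs2⟩ := exists_nat_pow_near (x := d / (R / 8)) (y := (2 : ℝ))
      (by rw [le_div_iff₀ (by positivity)]; linarith) (by norm_num)
    rw [le_div_iff₀ (by positivity)] at hs1
    rw [div_lt_iff₀ (by positivity)] at hs2
    have hs2 : d < r s := hs2
    have hs1 : r s ≤ 2 * d := by simp only [hr, pow_succ]; linarith
    -- The first tolerance keeps `G'` in the localized class; the second costs at most half of the
    -- noise increment.
    obtain ⟨G', hG'D, hG'1, hG'2⟩ := hω G hG (min (r s - d) (d ^ 2 / (8 * σ)))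
      (lt_min (by linarith) (by positivity))
    refine mem_iUnion.2 ⟨s, G', ⟨hG'D, hD𝒢 hG'D, ?_⟩, ?_⟩
    · have := empNorm_sub_le x G' G Gs
      have h3 := hG'1.trans_le (min_le_left _ _)
      linarith
    · have h3 : noiseSum ε x G ω - noiseSum ε x G' ω ≤ √n * (d ^ 2 / (8 * σ)) := by
        rw [noiseSum, noiseSum, ← mul_sub, ← Finset.sum_sub_distrib]
        calc _ ≤ (√n)⁻¹ * ∑ _i : Fin n, d ^ 2 / (8 * σ) := by
              gcongr with i
              have h4 := (hG'2 i).trans_le (min_le_right _ _)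
              have := (abs_lt.1 h4).1
              linarith
          _ = (√n)⁻¹ * (√n ^ 2 * (d ^ 2 / (8 * σ))) := by rw [hsn2]; simp
          _ = _ := by field_simp
      have h4 : √n * r s ^ 2 / (32 * σ) ≤ √n * d ^ 2 / (8 * σ) := by
        have h5 : r s ^ 2 ≤ (2 * d) ^ 2 := by
          have := hr0 s
          gcongr
        calc _ ≤ √n * (2 * d) ^ 2 / (32 * σ) := by gcongr
          _ = _ := by field_simp; norm_num
      have h5 : √n * d ^ 2 / (4 * σ) = √n * d ^ 2 / (8 * σ) + √n * (d ^ 2 / (8 * σ)) := by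
        field_simp; norm_num
      linarith
  calc _ ≤ μ (⋃ s, {ω | ∃ G ∈ D ∩ localized x 𝒢 Gs (r s),
        √n * r s ^ 2 / (32 * σ) ≤ noiseSum ε x G ω - noiseSum ε x Gs ω}) :=
        measure_mono_ae hsub
    _ ≤ ∑' s : ℕ, ENNReal.ofReal (4 * Real.exp (-(((s : ℝ) + 1) * q))) :=
        (measure_iUnion_le _).trans (ENNReal.tsum_le_tsum hchain)
    _ = ENNReal.ofReal 4 * ∑' s : ℕ, ENNReal.ofReal (Real.exp (-(((s : ℝ) + 1) * q))) := by
        rw [← ENNReal.tsum_mul_left]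
        exact tsum_congr fun s => ENNReal.ofReal_mul (by norm_num)
    _ ≤ ENNReal.ofReal 4 * ENNReal.ofReal (2 * Real.exp (-q)) := by
        gcongr
        exact tsum_ofReal_exp_le (by linarith)
    _ = ENNReal.ofReal (8 * Real.exp (-q)) := by
        rw [← ENNReal.ofReal_mul (by norm_num)]; congr 1; ring
    _ ≤ _ := by
        apply ENNReal.ofReal_le_ofReal
        -- Half of the exponent absorbs the prefactor, since `q ≥ 6`.
        have h8 : 8 ≤ Real.exp (q / 2) := by
          have := Real.quadratic_le_exp_of_nonneg (by positivity : 0 ≤ q / 2)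
          nlinarith
        have hqq : n * R ^ 2 / (10 ^ 9 * σ ^ 2) ≤ q / 2 := by
          have : n * R ^ 2 / (10 ^ 9 * σ ^ 2) = q * (64 / 1000) := by rw [hq]; field_simp; norm_num
          rw [this]; linarith
        calc 8 * Real.exp (-q) ≤ Real.exp (q / 2) * Real.exp (-q) := by gcongr
          _ = Real.exp (-(q / 2)) := by rw [← Real.exp_add]; congr 1; ring
          _ ≤ _ := by
              apply Real.exp_le_exp.2
              rw [neg_div]
              linarith

end FixedDesign

/-! ### Empirical versus population norm under random design -/

section Design

theorem exp_neg_le_one_sub_half {z : ℝ} (h0 : 0 ≤ z) (h1 : z ≤ 1) :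
    Real.exp (-z) ≤ 1 - z / 2 := by
  have h2 := Real.add_one_le_exp z
  rw [Real.exp_neg]
  calc (Real.exp z)⁻¹ ≤ (z + 1)⁻¹ := inv_anti₀ (by linarith) h2
    _ ≤ 1 - z / 2 := by
      rw [inv_le_iff_one_le_mul₀ (by linarith)]
      nlinarith

theorem norm_le_of_supNorm_le {X Y : Type*} [NormedAddCommGroup Y] {S : Set X} {f : X → Y}
    {r : ℝ} (hr : 0 ≤ r) (h : supNorm S f ≤ ENNReal.ofReal r) {x : X} (hx : x ∈ S) :
    ‖f x‖ ≤ r := by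
  have h1 : ‖f x‖ₑ ≤ ENNReal.ofReal r :=
    (le_iSup₂ (f := fun x (_ : x ∈ S) => ‖f x‖ₑ) x hx).trans h
  rw [← ofReal_norm] at h1
  exact (ENNReal.ofReal_le_ofReal_iff hr).1 h1

variable {X Y : Type*} [MeasurableSpace X] [NormedAddCommGroup Y]
variable {γ : Measure X} [IsProbabilityMeasure γ]

/-- The empirical norm of a bounded function is rarely much smaller than its `L²` norm. -/
theorem measure_empNorm_lt_le {n : ℕ} (hn : 0 < n) {f : X → Y} (hf : AEStronglyMeasurable f γ)
    {F : ℝ} (hF : 0 < F) (hfF : ∀ᵐ x ∂γ, ‖f x‖ ≤ F) {ρ : ℝ} (hρ : 0 ≤ ρ)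
    (hρf : ENNReal.ofReal ρ ≤ eLpNorm f 2 γ) :
    Measure.pi (fun _ : Fin n => γ) {x | empNorm x f < ρ / 2} ≤
      ENNReal.ofReal (Real.exp (-(n * ρ ^ 2) / (4 * F ^ 2))) := by
  have hn' : (0 : ℝ) < n := Nat.cast_pos.2 hn
  have hLp : MemLp f 2 γ := MemLp.of_bound hf F hfF
  have hsq : Integrable (fun x => ‖f x‖ ^ 2) γ := hLp.integrable_norm_pow (by norm_num)
  have hm : ρ ^ 2 ≤ ∫ x, ‖f x‖ ^ 2 ∂γ := by
    rw [hLp.eLpNorm_eq_integral_rpow_norm (by norm_num) (by norm_num)] at hρf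
    have h0 : 0 ≤ ∫ x, ‖f x‖ ^ 2 ∂γ := integral_nonneg fun x => by positivity
    have h1 : ρ ≤ √(∫ x, ‖f x‖ ^ 2 ∂γ) := by
      refine (ENNReal.ofReal_le_ofReal_iff (Real.sqrt_nonneg _)).1 ?_
      refine hρf.trans (le_of_eq ?_)
      rw [Real.sqrt_eq_rpow]
      simp
    calc ρ ^ 2 ≤ √(∫ x, ‖f x‖ ^ 2 ∂γ) ^ 2 := by gcongr
      _ = _ := Real.sq_sqrt h0
  -- Chernoff bound for the lower tail. The scale `F ^ 2` puts the exponent in `[-1, 0]`, where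
  -- `exp(-z) ≤ 1 - z / 2`, so only the second moment of `f` enters. The mean of `g` yields `-ρ² /
  -- (2F²)` per sample, and the event costs back half of it.
  set g : X → ℝ := fun x => Real.exp (-(‖f x‖ ^ 2 / F ^ 2)) with hg
  have hgm : AEStronglyMeasurable g γ :=
    (by fun_prop : Continuous fun v : ℝ => Real.exp (-(v / F ^ 2))).comp_aestronglyMeasurable
      hsq.aestronglyMeasurable
  have hg1 : ∀ x, g x ≤ 1 := fun x => Real.exp_le_one_iff.2 (by
    have : 0 ≤ ‖f x‖ ^ 2 / F ^ 2 := by positivity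
    linarith)
  have hgint : Integrable g γ := by
    refine Integrable.of_bound hgm 1 (Filter.Eventually.of_forall fun x => ?_)
    rw [Real.norm_of_nonneg (Real.exp_pos _).le]
    exact hg1 x
  have hgle : ∫ x, g x ∂γ ≤ Real.exp (-(ρ ^ 2 / (2 * F ^ 2))) := by
    calc ∫ x, g x ∂γ ≤ ∫ x, (1 - (1 / (2 * F ^ 2)) * ‖f x‖ ^ 2) ∂γ := by
          refine integral_mono_ae hgint ((integrable_const _).sub (hsq.const_mul _)) ?_
          filter_upwards [hfF] with x hx
          have h1 : ‖f x‖ ^ 2 / F ^ 2 ≤ 1 := by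
            rw [div_le_one (by positivity)]
            gcongr
          refine (exp_neg_le_one_sub_half (by positivity) h1).trans (le_of_eq ?_)
          field_simp
      _ = 1 - (1 / (2 * F ^ 2)) * ∫ x, ‖f x‖ ^ 2 ∂γ := by
          rw [integral_sub (integrable_const _) (hsq.const_mul _), integral_const_mul]
          simp
      _ ≤ 1 - (1 / (2 * F ^ 2)) * ρ ^ 2 := by gcongr
      _ = -(ρ ^ 2 / (2 * F ^ 2)) + 1 := by ring
      _ ≤ _ := Real.add_one_le_exp _
  have hprod : ∫ x : Fin n → X, ∏ i, g (x i) ∂(Measure.pi fun _ => γ) = (∫ x, g x ∂γ) ^ n := by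
    have := integral_fintype_prod_eq_pow (ι := Fin n) (μ := γ) g
    rwa [Fintype.card_fin] at this
  have hprodint : Integrable (fun x : Fin n → X => ∏ i, g (x i)) (Measure.pi fun _ => γ) :=
    Integrable.fintype_prod (f := fun _ => g) fun _ => hgint
  have hmarkov := mul_meas_ge_le_integral_of_nonneg
    (Filter.Eventually.of_forall fun x : Fin n → X =>
      Finset.prod_nonneg fun i _ => (Real.exp_pos (-(‖f (x i)‖ ^ 2 / F ^ 2))).le) hprodint
    (Real.exp (-(n * ρ ^ 2 / (4 * F ^ 2))))
  have hsub : {x : Fin n → X | empNorm x f < ρ / 2} ⊆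
      {x | Real.exp (-(n * ρ ^ 2 / (4 * F ^ 2))) ≤ ∏ i, g (x i)} := by
    intro x hx
    have hx : empNorm x f < ρ / 2 := hx
    show _ ≤ ∏ i, g (x i)
    rw [← Real.exp_sum, Real.exp_le_exp, Finset.sum_neg_distrib, neg_le_neg_iff, ← Finset.sum_div]
    have h1 : empNorm x f ^ 2 ≤ (ρ / 2) ^ 2 := by
      have := empNorm_nonneg x f
      gcongr
    rw [sq_empNorm, one_div, inv_mul_le_iff₀ hn'] at h1
    rw [div_le_div_iff₀ (by positivity) (by positivity)]
    nlinarith [sq_nonneg F]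
  refine (measure_mono hsub).trans ?_
  rw [← ofReal_measureReal]
  apply ENNReal.ofReal_le_ofReal
  rw [hprod] at hmarkov
  have hpow : (∫ x, g x ∂γ) ^ n ≤ Real.exp (-(ρ ^ 2 / (2 * F ^ 2))) ^ n := by
    gcongr
  have hfin := hmarkov.trans hpow
  rw [mul_comm, ← le_div_iff₀ (Real.exp_pos _), ← Real.exp_nat_mul, ← Real.exp_sub] at hfin
  refine hfin.trans (le_of_eq ?_)
  congr 1
  field_simp
  ring

/-- Uniformly over the class, functions that are far from `G₀` in `L²` are far from `G₀` in the
empirical norm, outside an exponentially unlikely set of designs. -/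
theorem exists_design_exceptional_set {n : ℕ} (hn : 0 < n) {S : Set X} (hS : ∀ᵐ x ∂γ, x ∈ S)
    {G₀ : X → Y} {𝒢 : Set (X → Y)} (hG₀ : AEStronglyMeasurable G₀ γ)
    (h𝒢 : ∀ G ∈ 𝒢, AEStronglyMeasurable G γ) {F : ℝ} (hF : 0 < F)
    (h𝒢F : ∀ G ∈ 𝒢, supNorm S (G - G₀) ≤ ENNReal.ofReal F) {δ R : ℝ} (hδ : 0 < δ)
    (hent : ENNReal.ofReal (10 ^ 5 * F ^ 2) * entropy 𝒢 (supDist S) δ ≤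
      ENNReal.ofReal (n * δ ^ 2)) (hδR : 10 ^ 5 * δ ≤ R) :
    ∃ A : Set (Fin n → X),
      Measure.pi (fun _ : Fin n => γ) A ≤
        ENNReal.ofReal (Real.exp (-(n * R ^ 2) / (80 * F ^ 2))) ∧
      ∀ x ∉ A, (∀ i, x i ∈ S) → ∀ G ∈ 𝒢, ENNReal.ofReal R ≤ eLpNorm (G - G₀) 2 γ →
        R / 4 ≤ empNorm x (G - G₀) := by
  have hR : 0 < R := by linarith
  set h : ℝ := n * δ ^ 2 / (10 ^ 5 * F ^ 2) with hh
  have hent' : entropy 𝒢 (supDist S) δ ≤ ENNReal.ofReal h := by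
    rw [hh, ENNReal.ofReal_div_of_pos (by positivity), ENNReal.le_div_iff_mul_le, mul_comm]
    · exact hent
    · left
      rw [Ne, ENNReal.ofReal_eq_zero, not_le]
      positivity
    · left; exact ENNReal.ofReal_ne_top
  obtain ⟨c, hc𝒢, hcov, hcard⟩ := exists_finset_cover (by positivity : 0 ≤ h) hent'
  -- Centres too close to `G₀` in `L²` contribute the empty set. The level is `R - δ` because
  -- passing from `G` to its centre loses `δ`.
  set B : (X → Y) → Set (Fin n → X) := fun G =>
    {x | ENNReal.ofReal (R - δ) ≤ eLpNorm (G - G₀) 2 γ ∧ empNorm x (G - G₀) < (R - δ) / 2} with hB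
  refine ⟨⋃ G ∈ c, B G, ?_, ?_⟩
  · calc _ ≤ ∑ G ∈ c, Measure.pi (fun _ : Fin n => γ) (B G) := measure_biUnion_finset_le _ _
      _ ≤ ∑ G ∈ c, ENNReal.ofReal (Real.exp (-(n * (R - δ) ^ 2) / (4 * F ^ 2))) := by
          refine Finset.sum_le_sum fun G hG => ?_
          by_cases hbig : ENNReal.ofReal (R - δ) ≤ eLpNorm (G - G₀) 2 γ
          · refine le_trans (measure_mono fun x hx => hx.2) (measure_empNorm_lt_le hn
              ((h𝒢 G (hc𝒢 G hG)).sub hG₀) hF ?_ (by linarith) hbig)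
            filter_upwards [hS] with x hx
            exact norm_le_of_supNorm_le hF.le (h𝒢F G (hc𝒢 G hG)) hx
          · have : B G = ∅ := by
              ext x
              simp only [hB, mem_empty_iff_false, iff_false]
              exact fun hx => hbig hx.1
            rw [this]
            simp
      _ = ENNReal.ofReal (c.card * Real.exp (-(n * (R - δ) ^ 2) / (4 * F ^ 2))) := by
          rw [Finset.sum_const, nsmul_eq_mul, ENNReal.ofReal_mul (by positivity)]
          simp
      _ ≤ _ := by
          apply ENNReal.ofReal_le_ofReal
          calc _ ≤ Real.exp h * Real.exp (-(n * (R - δ) ^ 2) / (4 * F ^ 2)) := by gcongr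
            _ = Real.exp (-(n * ((R - δ) ^ 2 / 4 - δ ^ 2 / 10 ^ 5)) / F ^ 2) := by
                rw [← Real.exp_add, hh]
                congr 1
                field_simp
                ring
            _ ≤ Real.exp (-(n * (R ^ 2 / 80)) / F ^ 2) := by
                gcongr
                nlinarith
            _ = _ := by
                congr 1
                field_simp
  · intro x hxA hxS G hG hGR
    obtain ⟨G', hG', hGG'⟩ := hcov G hG
    have hpt : ∀ z ∈ S, ‖(G - G') z‖ ≤ δ := fun z hz => norm_le_of_supNorm_le hδ.le hGG'.le hz
    have hL : eLpNorm (G - G') 2 γ ≤ ENNReal.ofReal δ := by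
      have := eLpNorm_le_of_ae_bound (p := 2) (μ := γ) (f := G - G') (C := δ)
        (by filter_upwards [hS] with z hz using hpt z hz)
      simpa using this
    have hbig : ENNReal.ofReal (R - δ) ≤ eLpNorm (G' - G₀) 2 γ := by
      rw [ENNReal.ofReal_sub _ hδ.le, tsub_le_iff_left]
      calc _ ≤ eLpNorm ((G - G') + (G' - G₀)) 2 γ := by
            rwa [sub_add_sub_cancel]
        _ ≤ _ := eLpNorm_add_le ((h𝒢 G hG).sub (h𝒢 G' (hc𝒢 G' hG')))
            ((h𝒢 G' (hc𝒢 G' hG')).sub hG₀) (by norm_num)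
        _ ≤ _ := by gcongr
    have hnot : (R - δ) / 2 ≤ empNorm x (G' - G₀) := by
      by_contra hcon
      exact hxA (mem_iUnion₂.2 ⟨G', hG', hbig, not_le.1 hcon⟩)
    have h1 := empNorm_sub_le x G' G G₀
    have h2 : empNorm x (G' - G) ≤ δ := by
      rw [empNorm_sub_comm]
      exact empNorm_le_of_forall x hδ.le fun i => hpt _ (hxS i)
    -- A second `δ` is lost in the empirical norm; `(R - δ) / 2 - δ ≥ R / 4` since `δ` is tiny
    -- compared with `R`.
    linarith

end Design

/-! ### Null-measurability and Fubini -/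

section Measurability

/-- A measurable hull of `B` differs from it by a null set, so almost all sections agree up to null
sets and Tonelli applies to the hull. -/
theorem measure_prod_le_of_ae_section_le {α β : Type*} [MeasurableSpace α] [MeasurableSpace β]
    {P : Measure α} {Q : Measure β} [IsProbabilityMeasure P] [SFinite Q] {B : Set (α × β)}
    (hB : NullMeasurableSet B (P.prod Q)) {q : ℝ≥0∞}
    (h : ∀ᵐ x ∂P, Q {y | (x, y) ∈ B} ≤ q) : P.prod Q B ≤ q := by
  have hae := Measure.ae_ae_of_ae_prod hB.toMeasurable_ae_eq.mem_iff
  rw [← measure_toMeasurable B, Measure.prod_apply (measurableSet_toMeasurable _ _)]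
  calc _ ≤ ∫⁻ _, q ∂P := by
        refine lintegral_mono_ae ?_
        filter_upwards [hae, h] with x hx hxq
        refine le_trans (measure_mono_ae ?_) hxq
        filter_upwards [hx] with y hy
        exact hy.1
    _ = q := by simp

variable {X Y Ω : Type*} [MeasurableSpace X] [NormedAddCommGroup Y] [MeasurableSpace Y]
  [MeasurableSpace Ω]

/-- The random map is replaced by finitely many fixed measurable ones, glued along measurable
events. Joint measurability of evaluation is thereby avoided. -/
theorem exists_measurable_selection {β : Type*} {S : Set X} {Ghat : Ω → X → Y}
    (hGhat : IsSupMeasurable S Ghat) {U : β → Set (UniformOnFun X Y {S})}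
    (hU : ∀ b, IsOpen (U b)) {g : β → X → Y} (t : Finset β) (hg : ∀ b ∈ t, Measurable (g b))
    {e : Ω → X} (he : Measurable e) :
    ∃ h : Ω → Y, Measurable h ∧ ∀ ω, (∃ b ∈ t, UniformOnFun.ofFun {S} (Ghat ω) ∈ U b) →
      ∃ b ∈ t, UniformOnFun.ofFun {S} (Ghat ω) ∈ U b ∧ h ω = g b (e ω) := by
  classical
  induction t using Finset.induction_on with
  | empty => exact ⟨fun _ => 0, measurable_const, by simp⟩
  | insert b t _ ih =>
    obtain ⟨h, hm, hh⟩ := ih fun b' hb' => hg b' (Finset.mem_insert_of_mem hb')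
    refine ⟨fun ω => if UniformOnFun.ofFun {S} (Ghat ω) ∈ U b then g b (e ω) else h ω,
      Measurable.ite (hGhat (MeasurableSpace.measurableSet_generateFrom (hU b)))
        ((hg b (Finset.mem_insert_self b t)).comp he) hm, fun ω hω => ?_⟩
    by_cases hb : UniformOnFun.ofFun {S} (Ghat ω) ∈ U b
    · exact ⟨b, Finset.mem_insert_self b t, hb, if_pos hb⟩
    · obtain ⟨b', hb', hU'⟩ := hω
      rcases Finset.mem_insert.1 hb' with rfl | hb't
      · exact absurd hU' hb
      · obtain ⟨b'', h1, h2, h3⟩ := hh ω ⟨b', hb't, hU'⟩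
        exact ⟨b'', Finset.mem_insert_of_mem h1, h2, by simp only [if_neg hb]; exact h3⟩

/-- Evaluating a random element of a compact class at a random point of `S` is measurable. -/
theorem aemeasurable_eval [BorelSpace Y] {ν : Measure Ω} {S : Set X} {𝒢 : Set (X → Y)}
    (hcomp : IsSupCompact S 𝒢) (h𝒢 : ∀ G ∈ 𝒢, Measurable G) {Ghat : Ω → X → Y}
    (hmem : ∀ ω, Ghat ω ∈ 𝒢) (hGhat : IsSupMeasurable S Ghat) {e : Ω → X} (he : Measurable e)
    (heS : ∀ᵐ ω ∂ν, e ω ∈ S) : AEMeasurable (fun ω => Ghat ω (e ω)) ν := by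
  refine aemeasurable_of_unif_approx fun η hη => ?_
  set U : UniformOnFun X Y {S} → Set (UniformOnFun X Y {S}) := fun f =>
    interior {g | ∀ z ∈ S, dist (UniformOnFun.toFun {S} f z) (UniformOnFun.toFun {S} g z) ≤ η}
    with hU
  obtain ⟨t, ht𝒢, htcov⟩ := hcomp.elim_nhds_subcover U (fun f _ => by
    refine interior_mem_nhds.2 (Filter.mem_of_superset (UniformOnFun.gen_mem_nhds Y {S} f
      (mem_singleton S) (Metric.dist_mem_uniformity hη)) fun g hg z hz => ?_)
    exact le_of_lt (hg z hz))
  obtain ⟨h, hm, hh⟩ := exists_measurable_selection hGhat (U := U) (fun f => isOpen_interior)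
    (g := fun f => UniformOnFun.toFun {S} f) t (fun f hf => by
      obtain ⟨G, hG, rfl⟩ := ht𝒢 f hf
      exact h𝒢 G hG) he
  refine ⟨h, hm.aemeasurable, ?_⟩
  filter_upwards [heS] with ω hω
  obtain ⟨f, -, hfU, hfh⟩ := hh ω (by simpa using htcov ⟨Ghat ω, hmem ω, rfl⟩)
  rw [hfh]
  exact interior_subset hfU (e ω) hω

end Measurability

end ERM

/-! ### Combining the two events -/

open ERM

theorem mainTheorem2 :
    ∃ C : ℝ, 0 < C ∧
      ∀ (X : Type*) [NormedAddCommGroup X] [InnerProductSpace ℝ X] [CompleteSpace X]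
        [TopologicalSpace.SeparableSpace X] [MeasurableSpace X] [BorelSpace X]
        (Y : Type*) [NormedAddCommGroup Y] [InnerProductSpace ℝ Y] [CompleteSpace Y]
        [TopologicalSpace.SeparableSpace Y] [MeasurableSpace Y] [BorelSpace Y]
        (Ω : Type*) [MeasurableSpace Ω] (μ : Measure Ω) [IsProbabilityMeasure μ]
        (γ : Measure X) [IsProbabilityMeasure γ]
        (n : ℕ) (_ : 0 < n) (σ : ℝ) (_ : 0 < σ)
        (G₀ : X → Y) (𝒢 : Set (X → Y)) (ε : Fin n → Y → Ω → ℝ)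
        (_ : (ERM.IsWhiteNoiseModel ε μ ∧ ERM.IsSeparableVersion γ 𝒢 ε μ) ∨
          ERM.IsSubGaussianModel ε μ)
        (Ghat : (Fin n → X) × Ω → X → Y) (_ : ERM.IsERM γ.support γ μ 𝒢 G₀ σ ε Ghat)
        (Gs : X → Y) (Ψ : ℝ → ℝ) (_ : ERM.Admissible n γ G₀ 𝒢 Gs Ψ)
        (F : ℝ) (_ : 0 ≤ F)
        (_ : ∀ G ∈ 𝒢, ERM.supNorm γ.support (G - G₀) ≤ ENNReal.ofReal F)
        (δ δ' : ℝ) (_ : 0 < δ) (_ : 0 < δ')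
        (_ : C * σ * Ψ δ ≤ √n * δ ^ 2)
        (_ : ENNReal.ofReal (C * F ^ 2) * ERM.entropy 𝒢 (ERM.supDist γ.support) δ' ≤
          ENNReal.ofReal (n * δ' ^ 2))
        (R : ℝ)
        (_ : C * max (max δ δ')
          (max (ERM.supNorm γ.support (Gs - G₀)).toReal ((σ + F) / √n)) ≤ R),
        ERM.jointLaw n γ μ {p | ENNReal.ofReal R ≤ eLpNorm (Ghat p - G₀) 2 γ} ≤
          ENNReal.ofReal (2 * Real.exp (-(n * R ^ 2) / (C ^ 2 * (σ ^ 2 + F ^ 2)))) := by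
  -- Its square `10 ^ 10` dominates both exponent constants, `80` and `10 ^ 9`.
  refine ⟨10 ^ 5, by norm_num, ?_⟩
  intro X _ _ _ _ _ _ Y _ _ _ _ _ _ Ω _ μ _ γ _ n hn σ hσ G₀ 𝒢 ε hε Ghat hGhat Gs Ψ hadm F hF
    h𝒢F δ δ' hδ hδ' hδΨ hδ'ent R hR
  have : SecondCountableTopology X := UniformSpace.secondCountable_of_separable X
  have : SecondCountableTopology Y := UniformSpace.secondCountable_of_separable Y
  have hn' : (0 : ℝ) < n := Nat.cast_pos.2 hn
  have hsn : 0 < √(n : ℝ) := Real.sqrt_pos.2 hn'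
  have hinc : HasSubgaussianIncrements ε μ :=
    hε.elim (fun h => h.1.hasSubgaussianIncrements) fun h => h.hasSubgaussianIncrements
  have hsep : IsSeparableVersion γ 𝒢 ε μ :=
    hε.elim (fun h => h.2) fun h => h.isSeparableVersion γ 𝒢
  have hle : ∀ a, a ≤ max (max δ δ') (max (supNorm γ.support (Gs - G₀)).toReal ((σ + F) / √n)) →
      10 ^ 5 * a ≤ R := fun a ha => (mul_le_mul_of_nonneg_left ha (by norm_num)).trans hR
  have hδR : 10 ^ 5 * δ ≤ R := hle _ (by simp)
  have hδ'R : 10 ^ 5 * δ' ≤ R := hle _ (by simp)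
  have hGsR : 10 ^ 5 * (supNorm γ.support (Gs - G₀)).toReal ≤ R := hle _ (by simp)
  have hσR : 10 ^ 5 * (σ / √n) ≤ R := by
    refine le_trans ?_ (hle ((σ + F) / √n) (by simp))
    gcongr
    linarith
  have hR0 : 0 < R := by linarith
  have hsupp : ∀ᵐ z ∂γ, z ∈ γ.support := Measure.support_mem_ae
  -- If `F = 0`, the estimator equals `G₀` on the support and the event is empty; otherwise one may
  -- divide by `F ^ 2`.
  rcases hF.eq_or_lt with rfl | hFpos
  · have hempty : {p | ENNReal.ofReal R ≤ eLpNorm (Ghat p - G₀) 2 γ} = ∅ := by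
      ext p
      simp only [mem_empty_iff_false, iff_false]
      intro hp
      have hzero : eLpNorm (Ghat p - G₀) 2 γ = 0 := by
        have : Ghat p - G₀ =ᵐ[γ] 0 := by
          filter_upwards [hsupp] with z hz
          exact norm_le_zero_iff.1 (norm_le_of_supNorm_le le_rfl (h𝒢F _ (hGhat.mem p)) hz)
        rw [eLpNorm_congr_ae this, eLpNorm_zero]
      have hp : ENNReal.ofReal R ≤ eLpNorm (Ghat p - G₀) 2 γ := hp
      rw [hzero, nonpos_iff_eq_zero, ENNReal.ofReal_eq_zero] at hp
      linarith
    rw [hempty]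
    simp
  set P : Measure (Fin n → X) := Measure.pi fun _ : Fin n => γ with hP
  have hPsupp : ∀ᵐ x ∂P, ∀ i, x i ∈ γ.support := ae_all_iff.2 fun i =>
    (measurePreserving_eval (fun _ : Fin n => γ) i).quasiMeasurePreserving.ae hsupp
  have hjsupp : ∀ᵐ p ∂(P.prod μ), ∀ i, p.1 i ∈ γ.support :=
    Measure.quasiMeasurePreserving_fst.ae hPsupp
  obtain ⟨A, hA, hAR⟩ := exists_design_exceptional_set hn hsupp
    hadm.measurable_G₀.aestronglyMeasurable
    (fun G hG => (hadm.measurable_class G hG).aestronglyMeasurable) hFpos h𝒢F hδ' hδ'ent hδ'R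
  set B : Set ((Fin n → X) × Ω) := {p | R / 4 ≤ empNorm p.1 (Ghat p - G₀)} with hB
  -- Only this event needs measurability: the `L²` event and `A` are handled through outer measure.
  have hBm : NullMeasurableSet B (P.prod μ) := by
    refine nullMeasurableSet_le aemeasurable_const ?_
    simp only [empNorm, Pi.sub_apply]
    refine (AEMeasurable.const_mul (Finset.aemeasurable_fun_sum _ fun i _ => ?_) _).sqrt
    have hi : Measurable fun p : (Fin n → X) × Ω => p.1 i :=
      (measurable_pi_apply i).comp measurable_fst
    refine ((AEMeasurable.sub ?_ (hadm.measurable_G₀.comp hi).aemeasurable).norm.pow_const 2)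
    exact aemeasurable_eval hadm.compact hadm.measurable_class hGhat.mem hGhat.measurable hi
      (hjsupp.mono fun p hp => hp i)
  have hBle : P.prod μ B ≤ ENNReal.ofReal (Real.exp (-(n * R ^ 2) / (10 ^ 9 * σ ^ 2))) := by
    refine measure_prod_le_of_ae_section_le hBm ?_
    have hmin := Measure.ae_ae_of_ae_prod hGhat.minimizes
    filter_upwards [hPsupp, hsep, hadm.entropy_bound, hmin] with x hxS hxsep hxJ hxmin
    obtain ⟨D, hD𝒢, hD, hDsep⟩ := hxsep
    have hGsx : empNorm x (Gs - G₀) ≤ R / 16 := by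
      refine empNorm_le_of_forall x (by positivity) fun i => ?_
      have hfin : supNorm γ.support (Gs - G₀) ≠ ∞ :=
        ((h𝒢F Gs hadm.mem).trans_lt ENNReal.ofReal_lt_top).ne
      have := norm_le_of_supNorm_le ENNReal.toReal_nonneg (ENNReal.ofReal_toReal hfin).ge (hxS i)
      linarith
    refine le_trans (measure_mono_ae ?_) (measure_fixedDesign_le (G₀ := G₀) hn hσ hinc hadm.mem
      hD𝒢 hD hDsep hadm.nonneg hadm.antitone hxJ hδ hδΨ hδR hσR hGsx)
    filter_upwards [hxmin] with ω hω hωB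
    exact ⟨Ghat (x, ω), hGhat.mem _, hω Gs hadm.mem, hωB⟩
  have hsub : ∀ᵐ p ∂(P.prod μ), ENNReal.ofReal R ≤ eLpNorm (Ghat p - G₀) 2 γ →
      p ∈ A ×ˢ univ ∪ B := by
    filter_upwards [hjsupp] with p hpS hp
    by_cases hpA : p.1 ∈ A
    · exact Or.inl ⟨hpA, mem_univ _⟩
    · exact Or.inr (hAR p.1 hpA hpS _ (hGhat.mem p) hp)
  calc jointLaw n γ μ {p | ENNReal.ofReal R ≤ eLpNorm (Ghat p - G₀) 2 γ}
      ≤ P.prod μ (A ×ˢ univ ∪ B) := measure_mono_ae hsub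
    _ ≤ P.prod μ (A ×ˢ univ) + P.prod μ B := measure_union_le _ _
    _ = P A + P.prod μ B := by rw [Measure.prod_prod, measure_univ, mul_one]
    _ ≤ ENNReal.ofReal (Real.exp (-(n * R ^ 2) / (80 * F ^ 2))) +
        ENNReal.ofReal (Real.exp (-(n * R ^ 2) / (10 ^ 9 * σ ^ 2))) := add_le_add hA hBle
    _ ≤ ENNReal.ofReal (Real.exp (-(n * R ^ 2) / ((10 ^ 5) ^ 2 * (σ ^ 2 + F ^ 2)))) +
        ENNReal.ofReal (Real.exp (-(n * R ^ 2) / ((10 ^ 5) ^ 2 * (σ ^ 2 + F ^ 2)))) := by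
        have hmono : ∀ c : ℝ, 0 < c → c ≤ (10 ^ 5) ^ 2 * (σ ^ 2 + F ^ 2) →
            ENNReal.ofReal (Real.exp (-(n * R ^ 2) / c)) ≤
            ENNReal.ofReal (Real.exp (-(n * R ^ 2) / ((10 ^ 5) ^ 2 * (σ ^ 2 + F ^ 2)))) := by
          intro c hc hcle
          rw [neg_div, neg_div]
          gcongr
        have h1 := sq_nonneg σ
        have h2 := sq_nonneg F
        exact add_le_add (hmono _ (by positivity) (by linarith))
          (hmono _ (by positivity) (by linarith))
    _ = _ := by
        rw [← ENNReal.ofReal_add (by positivity) (by positivity)]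
        congr 1
        ring
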